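/- **Theorem 4.4.** Let $\mathrm{Sch}_{\mathbb C}$ be the category of separated schemes of finite type over $\mathbb C$ and let $\mathrm{Var}_{\mathbb C}$ be its full subcategory of reduced schemes; for $U\in \mathrm{Var}_{\mathbb C}$ let $U^{an}$ be the set $U(\mathbb C)$ with the analytic topology. For a presheaf $E$ of simplicial sets, of pointed simplicial sets, or of spectra on $\mathrm{Sch}_{\mathbb C}$, a topological space $T$ and $X\in \mathrm{Sch}_{\mathbb C}$, put $$E(T\times X):=\operatorname*{colim}_{(f,U)\in (T|\mathrm{Var}_{\mathbb C})^{op}} E(U\times X),$$ where $(T|\mathrm{Var}_{\mathbb C})$ is the category of pairs $(f,U)$ of an object $U\in \mathrm{Var}_{\mathbb C}$ and a continuous map $f:T\to U^{an}$, whose morphisms $(f,U)\to (g,V)$ are the morphisms $h:U\to V$ with $h^{an}\circ f=g$. The semi-topologization $E^{sst}$ is the presheaf on $\mathrm{Sch}_{\mathbb C}$ of simplicial sets (respectively pointed simplicial sets, spectra) for which $E^{sst}(X)$ is the diagonal of the simplicial object $n\mapsto E(\Delta^n_{top}\times X)$, where $\Delta^n_{top}$ is the standard topological $n$-simplex. Here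 a spectrum is a sequence of pointed simplicial sets $E_0,E_1,\dots$ with structure maps $S^1\wedge E_n\to E_{n+1}$, colimits and diagonals of spectra are formed levelwise, and a weak equivalence of spectra is a map that induces isomorphisms on all stable homotopy groups $\pi_k(E)=\operatorname{colim}_n \pi_{n+k}(|E_n|)$, $k\in\mathbb Z$. A weak equivalence of simplicial sets is a map whose geometric realization is a weak homotopy equivalence, and a weak equivalence of pointed simplicial sets is a pointed map that is a weak equivalence of the underlying simplicial sets. Let $E$ be a presheaf of simplicial sets (respectively of pointed simplicial sets, of spectra) on $\mathrm{Sch}_{\mathbb C}$, let $X\in \mathrm{Sch}_{\mathbb C}$, and let $\pi:\mathbb A^1_{\mathbb C}\times X\to X$ be the projection. Then $$\pi^*:E^{sst}(X)\to E^{sst}(\mathbb A^1_{\mathbb C}\times X)$$ is a weak equivalence of simplicial sets (respectively of pointed simplicial sets, of spectra). -/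

import Mathlib

open CategoryTheory Limits Opposite

universe u

namespace SemiTop

open AlgebraicGeometry

noncomputable section

/-- `Spec ℂ`. -/
abbrev specC : Scheme.{0} := Spec (CommRingCat.of ℂ)

/-- The property of being separated and of finite type. -/
def finTypeSep : MorphismProperty Scheme.{0} :=
  fun _ _ f => IsSeparated f ∧ LocallyOfFiniteType f ∧ QuasiCompact f

instance : finTypeSep.IsMultiplicative where
  id_mem _ := ⟨inferInstance, inferInstance, inferInstance⟩
  comp_mem f g hf hg := by
    obtain ⟨_, _, _⟩ := hf
    obtain ⟨_, _, _⟩ := hg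
    exact ⟨inferInstance, inferInstance, inferInstance⟩

instance : finTypeSep.IsStableUnderBaseChange where
  of_isPullback sq h := ⟨MorphismProperty.of_isPullback (P := @IsSeparated) sq h.1,
    MorphismProperty.of_isPullback (P := @LocallyOfFiniteType) sq h.2.1,
    MorphismProperty.of_isPullback (P := @QuasiCompact) sq h.2.2⟩

instance : finTypeSep.HasOfPostcompProperty finTypeSep where
  of_postcomp f g hg hfg := by
    obtain ⟨_, _, _⟩ := hg
    obtain ⟨_, _, _⟩ := hfg
    exact ⟨IsSeparated.of_comp f g, locallyOfFiniteType_of_comp f g, QuasiCompact.of_comp f g⟩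

/-- `Sch_ℂ`: the category of separated schemes of finite type over `ℂ`, with all morphisms of
schemes over `ℂ`. -/
abbrev SchC := finTypeSep.Over ⊤ specC

/-- Affine schemes locally of finite type over `ℂ` form an essentially small class. -/
lemma essentiallySmall_affine :
    ObjectProperty.EssentiallySmall.{0} (fun Y : Over specC =>
      IsAffine Y.left ∧ LocallyOfFiniteType Y.hom) := by
  let P : MorphismProperty Scheme.{0} := @LocallyOfFiniteType
  have : P.RespectsIso := MorphismProperty.IsStableUnderBaseChange.respectsIso (P := @LocallyOfFiniteType)
  have : EssentiallySmall.{0} (P.CostructuredArrow ⊤ Scheme.Spec specC) :=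
    essentiallySmall_costructuredArrow_Spec P le_rfl
  let e := equivSmallModel.{0} (P.CostructuredArrow ⊤ Scheme.Spec specC)
  refine ⟨.ofObj (fun x => Over.mk (e.inverse.obj x).hom), inferInstance, ?_⟩
  rintro Y ⟨h1, h2⟩
  let Z : P.CostructuredArrow ⊤ Scheme.Spec specC :=
    .mk (A := op Γ(Y.left, ⊤)) _ (Y.left.isoSpec.inv ≫ Y.hom)
      (inferInstanceAs (LocallyOfFiniteType (Y.left.isoSpec.inv ≫ Y.hom)))
  let i := e.unitIso.app Z
  refine ⟨_, .mk (e.functor.obj Z), ⟨?_⟩⟩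
  refine Over.isoMk Y.left.isoSpec (Y.left.isoSpec.hom_inv_id_assoc Y.hom) ≪≫
    (((MorphismProperty.CostructuredArrow.toOver _ Scheme.Spec specC) ⋙
      MorphismProperty.Over.forget _ _ _).mapIso i)

/-- The category `Sch_ℂ` is essentially small: each object is the quotient of an affine scheme by
an affine equivalence relation. -/
lemma essentiallySmall_schC : EssentiallySmall.{0} SchC := by
  let Q : ObjectProperty (Over specC) := fun Y => IsAffine Y.left ∧ LocallyOfFiniteType Y.hom
  have hQ : ObjectProperty.EssentiallySmall.{0} Q := essentiallySmall_affine
  obtain ⟨Q₀, _, h₁, h₂⟩ := ObjectProperty.EssentiallySmall.exists_small_le Q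
  have h : (finTypeSep.overObj (X := specC)) ≤ Q₀.colimitsOfShape WalkingParallelPair := by
    intro X hX
    obtain ⟨_, _, _⟩ : finTypeSep X.hom := hX
    rw [← ObjectProperty.colimitsOfShape_isoClosure]
    refine ObjectProperty.colimitsOfShape_monotone _ h₂ _ ?_
    have : CompactSpace X.left := QuasiCompact.compactSpace_of_compactSpace X.hom
    have : IsSeparated (terminal.from X.left) := by
      rw [← terminal.comp_from X.hom]; infer_instance
    let 𝒰 : X.left.OpenCover := X.left.affineCover.finiteSubcover
    let p : ∐ 𝒰.X ⟶ X.left := Sigma.desc 𝒰.f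
    have : IsAffine (∐ 𝒰.X) := inferInstance
    have : Surjective p := inferInstance
    have : Flat p := inferInstance
    have : LocallyOfFiniteType p :=
      have : IsZariskiLocalAtSource (@LocallyOfFiniteType.{0}) :=
        HasRingHomProperty.instIsZariskiLocalAtSource
      IsZariskiLocalAtSource.sigmaDesc (P := @LocallyOfFiniteType) (fun i => inferInstance)
    have : X.left.IsSeparated := ⟨inferInstance⟩
    have : QuasiSeparatedSpace X.left := inferInstance
    have : QuasiCompact p := inferInstance
    have : IsAffineHom p := by
      have : IsAffineHom (p ≫ terminal.from X.left) := by rw [terminal.comp_from]; infer_instance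
      exact IsAffineHom.of_comp p (terminal.from X.left)
    have : IsAffine (pullback p p) := isAffine_of_isAffineHom (pullback.fst p p)
    have : EffectiveEpi p := inferInstance
    let U : Over specC := Over.mk (p ≫ X.hom)
    let W : Over specC := Over.mk (pullback.fst p p ≫ p ≫ X.hom)
    let a : W ⟶ U := Over.homMk (pullback.fst p p)
    let b : W ⟶ U := Over.homMk (pullback.snd p p) (by simp [U, W, pullback.condition_assoc])
    let q : U ⟶ X := Over.homMk p
    have w : a ≫ q = b ≫ q := by ext; exact pullback.condition
    let c : Cofork a b := Cofork.ofπ q w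
    have hc : IsColimit c := by
      have key (s : Cofork a b) {Z : Scheme.{0}} (g₁ g₂ : Z ⟶ ∐ 𝒰.X) (hg : g₁ ≫ p = g₂ ≫ p) :
          g₁ ≫ s.π.left = g₂ ≫ s.π.left := by
        have h : pullback.fst p p ≫ s.π.left = pullback.snd p p ≫ s.π.left :=
          congrArg CommaMorphism.left s.condition
        rw [← pullback.lift_fst g₁ g₂ hg, Category.assoc, h, pullback.lift_snd_assoc]
      refine Cofork.IsColimit.mk c
        (fun s => Over.homMk (EffectiveEpi.desc p s.π.left (key s)) ?_) ?_ ?_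
      · rw [← cancel_epi p, EffectiveEpi.fac_assoc]
        exact Over.w s.π
      · intro s
        ext
        exact EffectiveEpi.fac p s.π.left (key s)
      · intro s m hm
        ext
        refine EffectiveEpi.uniq p s.π.left (key s) m.left ?_
        exact congrArg CommaMorphism.left hm
    refine ⟨{ diag := parallelPair a b, ι := c.ι, isColimit := hc, prop_diag_obj := ?_ }⟩
    rintro (_ | _)
    · exact ⟨inferInstanceAs (IsAffine (pullback p p)),
        inferInstanceAs (LocallyOfFiniteType (pullback.fst p p ≫ p ≫ X.hom))⟩
    · exact ⟨inferInstanceAs (IsAffine (∐ 𝒰.X)),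
        inferInstanceAs (LocallyOfFiniteType (p ≫ X.hom))⟩
  have : ObjectProperty.EssentiallySmall.{0} (finTypeSep.overObj (X := specC)) := by
    rw [← ObjectProperty.isoClosure_strictColimitsOfShape] at h
    exact .of_le h
  have : EssentiallySmall.{0} (finTypeSep.overObj (X := specC)).FullSubcategory := inferInstance
  let F := (finTypeSep.overObj (X := specC)).lift
    (MorphismProperty.Over.forget finTypeSep ⊤ specC) (fun Y => Y.prop)
  have : F.Full := ⟨fun f => ⟨(MorphismProperty.Over.forget finTypeSep ⊤ specC).preimage f.hom, by
    ext : 1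
    exact (MorphismProperty.Over.forget finTypeSep ⊤ specC).map_preimage f.hom⟩⟩
  have : F.Faithful := ⟨fun {_ _} f g h => by
    ext : 1
    exact congrArg (fun t => CommaMorphism.left t.hom) h⟩
  exact essentiallySmall_of_fully_faithful F

/-- Reducedness. -/
abbrev isReducedProp : ObjectProperty SchC := fun X => IsReduced X.left

/-- `Var_ℂ`: the reduced schemes in `Sch_ℂ`. -/
abbrev VarC := isReducedProp.FullSubcategory

/-- The complex points of `X`: sections of the structure morphism `X ⟶ Spec ℂ`. -/
@[ext]
structure Points (X : SchC) : Type where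
  hom : specC ⟶ X.left
  w : hom ≫ X.hom = 𝟙 specC

/-- The value `f(p) ∈ ℂ` of a regular function `f` on an open `V` at a complex point `p`
lying in `V`. -/
def evalAt {X : SchC} (p : Points X) (V : X.left.Opens) (h : ⊤ ≤ p.hom ⁻¹ᵁ V)
    (f : Γ(X.left, V)) : ℂ :=
  (Scheme.ΓSpecIso (CommRingCat.of ℂ)).hom (p.hom.appLE V ⊤ h f)

/-- The complex points lying in `V` at which the regular function `f` takes a value in `W`. -/
def basicSet {X : SchC} (V : X.left.Opens) (f : Γ(X.left, V)) (W : Set ℂ) : Set (Points X) :=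
  {p | ∃ h : ⊤ ≤ p.hom ⁻¹ᵁ V, evalAt p V h f ∈ W}

/-- The analytic topology on `X(ℂ)`: the coarsest topology for which the complex points of every
Zariski open form an open set, on which every regular function is continuous. -/
instance (X : SchC) : TopologicalSpace (Points X) :=
  TopologicalSpace.generateFrom
    {A | ∃ (V : X.left.Opens) (f : Γ(X.left, V)) (W : Set ℂ), IsOpen W ∧ A = basicSet V f W}

/-- The map induced by a morphism on complex points. -/
def pointsMap {X Y : SchC} (φ : X ⟶ Y) (p : Points X) : Points Y :=
  ⟨p.hom ≫ φ.left, by rw [Category.assoc, MorphismProperty.Over.w]; exact p.w⟩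

lemma continuous_pointsMap {X Y : SchC} (φ : X ⟶ Y) : Continuous (pointsMap φ) := by
  refine continuous_generateFrom_iff.2 ?_
  rintro _ ⟨V, f, W, hW, rfl⟩
  refine TopologicalSpace.isOpen_generateFrom_of_mem
    ⟨φ.left ⁻¹ᵁ V, φ.left.app V f, W, hW, ?_⟩
  ext p
  refine exists_congr fun h => ?_
  have : (p.hom ≫ φ.left).appLE V ⊤ h f = p.hom.appLE (φ.left ⁻¹ᵁ V) ⊤ h (φ.left.app V f) :=
    congrArg (fun t => t f) (congrArg CommRingCat.Hom.hom
      (Scheme.Hom.comp_appLE p.hom φ.left V ⊤ h))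
  exact iff_of_eq (congrArg (fun z => (Scheme.ΓSpecIso (CommRingCat.of ℂ)).hom z ∈ W) this)

/-- The analytification functor `U ↦ U^an` on reduced schemes. -/
def an : VarC ⥤ TopCat.{0} where
  obj U := TopCat.of (Points U.obj)
  map φ := TopCat.ofHom ⟨pointsMap φ.hom, continuous_pointsMap φ.hom⟩
  map_id U := by
    refine TopCat.hom_ext (ContinuousMap.ext fun p => Points.ext ?_)
    exact Category.comp_id p.hom
  map_comp φ ψ := by
    refine TopCat.hom_ext (ContinuousMap.ext fun p => Points.ext ?_)
    exact (Category.assoc p.hom φ.hom.left ψ.hom.left).symm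

instance : EssentiallySmall.{0} SchC := essentiallySmall_schC

/-- The category of pairs `(f : T ⟶ U^an, U)` with `U` reduced is `StructuredArrow T an`. -/
instance (T : TopCat.{0}) : EssentiallySmall.{0} (StructuredArrow T an) := by
  have : EssentiallySmall.{0} VarC := essentiallySmall_of_fully_faithful isReducedProp.ι
  infer_instance

section Semi

universe v w

variable {M : Type w} [Category.{v} M]

/-- The diagram `(f : T ⟶ U^an, U) ↦ E(U × X)`. -/
def diagram (E : SchCᵒᵖ ⥤ M) (T : TopCat.{0}) (X : SchC) : (StructuredArrow T an)ᵒᵖ ⥤ M where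
  obj d := E.obj (op (d.unop.right.obj ⨯ X))
  map h := E.map (prod.map h.unop.right.hom (𝟙 X)).op
  map_id d := by
    rw [← E.map_id]
    congr 1
    exact Quiver.Hom.unop_inj (by simp)
  map_comp h k := by
    rw [← E.map_comp]
    congr 1
    exact Quiver.Hom.unop_inj (by simp)

lemma map_swap (E : SchCᵒᵖ ⥤ M) {U V X X' : SchC} (h : U ⟶ V) (φ : X ⟶ X') {Z : M}
    (z : E.obj (op (U ⨯ X)) ⟶ Z) :
    E.map (prod.map h (𝟙 X')).op ≫ E.map (prod.map (𝟙 U) φ).op ≫ z =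
      E.map (prod.map (𝟙 V) φ).op ≫ E.map (prod.map h (𝟙 X)).op ≫ z := by
  rw [← E.map_comp_assoc, ← E.map_comp_assoc]
  congr 2
  exact Quiver.Hom.unop_inj (by simp)

variable [HasColimitsOfSize.{0, 0} M]

instance (T : TopCat.{0}) : HasColimitsOfShape (StructuredArrow T an)ᵒᵖ M :=
  hasColimitsOfShape_of_essentiallySmall _ M

/-- `E(T × X)`, the colimit of `E(U × X)` over all pairs `(f : T ⟶ U^an, U)`. -/
def value (E : SchCᵒᵖ ⥤ M) (T : TopCat.{0}) (X : SchC) : M :=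
  colimit (diagram E T X)

/-- The map `E(U × X) ⟶ E(T × X)` belonging to a pair `(f : T ⟶ U^an, U)`. -/
def valueι (E : SchCᵒᵖ ⥤ M) {T : TopCat.{0}} (X : SchC) {U : VarC} (f : T ⟶ an.obj U) :
    E.obj (op (U.obj ⨯ X)) ⟶ value E T X :=
  colimit.ι (diagram E T X) (op (StructuredArrow.mk f))

lemma map_valueι (E : SchCᵒᵖ ⥤ M) {T : TopCat.{0}} (X : SchC) {U V : VarC} (f : T ⟶ an.obj U)
    (g : T ⟶ an.obj V) (h : U ⟶ V) (w : f ≫ an.map h = g) :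
    E.map (prod.map h.hom (𝟙 X)).op ≫ valueι E X f = valueι E X g :=
  colimit.w (diagram E T X)
    (StructuredArrow.homMk h w : StructuredArrow.mk f ⟶ StructuredArrow.mk g).op

/-- The functoriality of `E(T × X)` in `T` and `X`: the summand of `(f, U)` is sent to the
summand of `(f ∘ α, U)` by `E(U × φ)`. -/
def valueMap (E : SchCᵒᵖ ⥤ M) {T T' : TopCat.{0}} {X X' : SchC} (α : T ⟶ T') (φ : X ⟶ X') :
    value E T' X' ⟶ value E T X :=
  colimit.desc (diagram E T' X')
    { pt := value E T X
      ι :=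
        { app d := E.map (prod.map (𝟙 _) φ).op ≫ valueι E X (α ≫ d.unop.hom)
          naturality d d' h := by
            have hw : (α ≫ d'.unop.hom) ≫ an.map h.unop.right = α ≫ d.unop.hom := by
              rw [Category.assoc, StructuredArrow.w]
            refine Eq.trans ?_ (Category.comp_id _).symm
            rw [← map_valueι E X _ _ h.unop.right hw]
            exact map_swap E h.unop.right.hom φ _ } }

lemma ι_valueMap (E : SchCᵒᵖ ⥤ M) {T T' : TopCat.{0}} {X X' : SchC} (α : T ⟶ T') (φ : X ⟶ X')
    {U : VarC} (f : T' ⟶ an.obj U) :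
    valueι E X' f ≫ valueMap E α φ = E.map (prod.map (𝟙 U.obj) φ).op ≫ valueι E X (α ≫ f) :=
  colimit.ι_desc _ _

lemma value_hom_ext (E : SchCᵒᵖ ⥤ M) {T : TopCat.{0}} {X : SchC} {Z : M}
    {a b : value E T X ⟶ Z}
    (h : ∀ (U : VarC) (f : T ⟶ an.obj U), valueι E X f ≫ a = valueι E X f ≫ b) : a = b :=
  colimit.hom_ext fun d => h _ d.unop.hom

lemma valueMap_id (E : SchCᵒᵖ ⥤ M) (T : TopCat.{0}) (X : SchC) :
    valueMap E (𝟙 T) (𝟙 X) = 𝟙 (value E T X) := by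
  refine value_hom_ext E fun U f => ?_
  rw [ι_valueMap, Category.id_comp, Category.comp_id, prod.map_id_id, op_id, E.map_id,
    Category.id_comp]

lemma valueMap_comp (E : SchCᵒᵖ ⥤ M) {T T' T'' : TopCat.{0}} {X X' X'' : SchC}
    (α : T ⟶ T') (β : T' ⟶ T'') (φ : X ⟶ X') (ψ : X' ⟶ X'') :
    valueMap E β ψ ≫ valueMap E α φ = valueMap E (α ≫ β) (φ ≫ ψ) := by
  refine value_hom_ext E fun U f => ?_
  rw [← Category.assoc, ι_valueMap, Category.assoc, ι_valueMap, ι_valueMap, Category.assoc,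
    ← E.map_comp_assoc]
  congr 2
  exact Quiver.Hom.unop_inj (by simp)

/-- The cosimplicial space `n ↦ Δⁿ_top`. -/
abbrev topSimplex : SimplexCategory ⥤ TopCat.{0} := SimplexCategory.toTop₀

/-- The presheaf of simplicial objects `X ↦ (n ↦ E(Δⁿ_top × X))`. -/
def semi (E : SchCᵒᵖ ⥤ M) : SchCᵒᵖ ⥤ SimplicialObject M where
  obj X :=
    { obj n := value E (topSimplex.obj n.unop) X.unop
      map θ := valueMap E (topSimplex.map θ.unop) (𝟙 _)
      map_id n := by
        rw [unop_id, CategoryTheory.Functor.map_id, valueMap_id]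
      map_comp θ η := by
        refine Eq.trans ?_ (valueMap_comp E _ _ _ _).symm
        rw [unop_comp, CategoryTheory.Functor.map_comp, Category.comp_id] }
  map φ :=
    { app n := valueMap E (𝟙 _) φ.unop
      naturality n m θ := by
        refine (valueMap_comp E _ _ _ _).trans (Eq.trans ?_ (valueMap_comp E _ _ _ _).symm)
        exact congrArg₂ (valueMap E) ((Category.id_comp _).trans (Category.comp_id _).symm)
          ((Category.comp_id _).trans (Category.id_comp _).symm) }
  map_id X := by
    ext n
    exact valueMap_id E _ _
  map_comp φ ψ := by
    ext n
    exact (congrArg (valueMap E · _) (Category.comp_id _).symm).trans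
      (valueMap_comp E _ _ _ _).symm

/-- The semi-topologization of `E`, formed with a given notion `δ` of diagonal of a simplicial
object of `M`: the presheaf `X ↦ δ (n ↦ E(Δⁿ_top × X))`. -/
def sst (δ : SimplicialObject M ⥤ M) (E : SchCᵒᵖ ⥤ M) : SchCᵒᵖ ⥤ M := semi E ⋙ δ

end Semi

/-- The affine line over `ℂ`. -/
def A1 : SchC :=
  MorphismProperty.Over.mk ⊤ (𝔸(Fin 1; specC) ↘ specC)
    ⟨inferInstance, inferInstance, inferInstance⟩

section Pointed

/-- The relation generating the colimit of a diagram of pointed sets. -/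
inductive PointedColimRel {J : Type} [SmallCategory J] (F : J ⥤ Pointed.{u}) :
    Option (Σ j, F.obj j) → Option (Σ j, F.obj j) → Prop where
  | base (j : J) : PointedColimRel F (some ⟨j, (F.obj j).point⟩) none
  | map {j k : J} (h : j ⟶ k) (x : F.obj j) :
      PointedColimRel F (some ⟨j, x⟩) (some ⟨k, (F.map h).toFun x⟩)

lemma pointed_comp_apply {A B C : Pointed.{u}} (f : A ⟶ B) (g : B ⟶ C) (x : A) :
    (f ≫ g).toFun x = g.toFun (f.toFun x) := rfl

lemma pointed_id_apply {A : Pointed.{u}} (x : A) : Pointed.Hom.toFun (𝟙 A) x = x := rfl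

lemma pointed_hom_ext {A B : Pointed.{u}} {f g : A ⟶ B} (h : ∀ x, f.toFun x = g.toFun x) :
    f = g := Pointed.Hom.ext (funext h)

/-- The colimit cocone of a diagram of pointed sets. -/
def pointedCocone {J : Type} [SmallCategory J] (F : J ⥤ Pointed.{u}) : Cocone F where
  pt := { X := Quot (PointedColimRel F), point := Quot.mk _ none }
  ι :=
    { app j := { toFun x := Quot.mk _ (some ⟨j, x⟩), map_point := Quot.sound (.base j) }
      naturality _ _ h := pointed_hom_ext fun x => (Quot.sound (.map h x)).symm }

/-- It is a colimit. -/
def pointedCoconeIsColimit {J : Type} [SmallCategory J] (F : J ⥤ Pointed.{u}) :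
    IsColimit (pointedCocone F) where
  desc s :=
    { toFun := Quot.lift (fun z => z.elim s.pt.point fun y => (s.ι.app y.1).toFun y.2) (by
        rintro _ _ (⟨j⟩ | ⟨h, x⟩)
        · exact (s.ι.app j).map_point
        · exact (congrArg (fun t : F.obj _ ⟶ s.pt => t.toFun x) (s.w h)).symm)
      map_point := rfl }
  fac s j := rfl
  uniq s m hm := pointed_hom_ext fun x => by
    obtain ⟨_ | ⟨j, y⟩⟩ := x
    · exact m.map_point
    · exact congrArg (fun t : F.obj j ⟶ s.pt => t.toFun y) (hm j)

instance : HasColimitsOfSize.{0, 0} Pointed.{u} :=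
  ⟨fun _ _ => ⟨fun F => ⟨⟨⟨_, pointedCoconeIsColimit F⟩⟩⟩⟩⟩

/-- Two points of `A × B` are identified in the smash product if they are equal or both lie in
`A ∨ B = A × {*} ∪ {*} × B`. -/
def smashSetoid (A B : Pointed.{u}) : Setoid (A × B) where
  r p q := p = q ∨ (p.1 = A.point ∨ p.2 = B.point) ∧ (q.1 = A.point ∨ q.2 = B.point)
  iseqv := ⟨fun _ => .inl rfl, by
    rintro _ _ (rfl | h)
    · exact .inl rfl
    · exact .inr h.symm, by
    rintro _ _ _ (rfl | h) (rfl | h')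
    · exact .inl rfl
    · exact .inr h'
    · exact .inr h
    · exact .inr ⟨h.1, h'.2⟩⟩

/-- The smash product `A ∧ B = (A × B) / (A ∨ B)` of pointed sets. -/
def smash (A B : Pointed.{u}) : Pointed.{u} where
  X := Quotient (smashSetoid A B)
  point := Quotient.mk _ (A.point, B.point)

/-- The class of `(a, b)` in `A ∧ B`. -/
def smashMk (A B : Pointed.{u}) (a : A) (b : B) : smash A B := Quotient.mk (smashSetoid A B) (a, b)

lemma smashMk_left {A B : Pointed.{u}} (b : B) : smashMk A B A.point b = (smash A B).point :=
  Quotient.sound (.inr ⟨.inl rfl, .inl rfl⟩)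

lemma smashMk_right {A B : Pointed.{u}} (a : A) : smashMk A B a B.point = (smash A B).point :=
  Quotient.sound (.inr ⟨.inr rfl, .inl rfl⟩)

/-- The universal property of the smash product. -/
def smashLift {A B C : Pointed.{u}} (f : A → B → C) (h₁ : ∀ b, f A.point b = C.point)
    (h₂ : ∀ a, f a B.point = C.point) : smash A B ⟶ C where
  toFun := Quotient.lift (fun p : A × B => f p.1 p.2) (by
    have key : ∀ p : A × B, p.1 = A.point ∨ p.2 = B.point → f p.1 p.2 = C.point := by
      rintro ⟨a, b⟩ (h | h)
      · exact (congrArg (f · b) h).trans (h₁ b)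
      · exact (congrArg (f a) h).trans (h₂ a)
    rintro p q (rfl | h)
    · rfl
    · exact (key p h.1).trans (key q h.2).symm)
  map_point := h₁ _

lemma smash_hom_ext {A B C : Pointed.{u}} {f g : smash A B ⟶ C}
    (h : ∀ a b, f.toFun (smashMk A B a b) = g.toFun (smashMk A B a b)) : f = g :=
  pointed_hom_ext fun x => Quotient.inductionOn x fun p => h p.1 p.2

/-- The map `f ∧ g`. -/
def smashMap {A A' B B' : Pointed.{u}} (f : A ⟶ A') (g : B ⟶ B') : smash A B ⟶ smash A' B' :=
  smashLift (fun a b => smashMk A' B' (f.toFun a) (g.toFun b))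
    (fun b => by rw [f.map_point]; exact smashMk_left _)
    (fun a => by rw [g.map_point]; exact smashMk_right _)

/-- Pointed maps form a pointed set, based at the constant map. -/
def pointedHom (A B : Pointed.{u}) : Pointed.{u} where
  X := A ⟶ B
  point := { toFun _ := B.point, map_point := rfl }

/-- The functor `A ∧ -`. -/
def smashFunctor (A : Pointed.{u}) : Pointed.{u} ⥤ Pointed.{u} where
  obj B := smash A B
  map g := smashMap (𝟙 A) g
  map_id _ := smash_hom_ext fun _ _ => rfl
  map_comp _ _ := smash_hom_ext fun _ _ => rfl

/-- The functor of pointed maps out of `A`. -/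
def homFunctor (A : Pointed.{u}) : Pointed.{u} ⥤ Pointed.{u} where
  obj B := pointedHom A B
  map g :=
    { toFun f := f ≫ g
      map_point := pointed_hom_ext fun _ => g.map_point }
  map_id _ := rfl
  map_comp _ _ := rfl

/-- `A ∧ -` is left adjoint to pointed maps out of `A`. -/
def smashAdj (A : Pointed.{u}) : smashFunctor A ⊣ homFunctor A :=
  Adjunction.mkOfHomEquiv
    { homEquiv B C :=
        { toFun f :=
            { toFun b :=
                { toFun a := f.toFun (smashMk A B a b)
                  map_point := (congrArg f.toFun (smashMk_left b)).trans f.map_point }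
              map_point := pointed_hom_ext fun a =>
                (congrArg f.toFun (smashMk_right a)).trans f.map_point }
          invFun g := smashLift (fun a b => (g.toFun b).toFun a) (fun b => (g.toFun b).map_point)
            (fun a => congrArg (fun t : A ⟶ C => t.toFun a) g.map_point)
          left_inv _ := smash_hom_ext fun _ _ => rfl
          right_inv _ := rfl }
      homEquiv_naturality_left_symm _ _ := smash_hom_ext fun _ _ => rfl
      homEquiv_naturality_right _ _ := rfl }

instance (A : Pointed.{u}) : (smashFunctor A).IsLeftAdjoint := (smashAdj A).isLeftAdjoint

end Pointed

open scoped Simplicial Topology Topology.Homotopy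

/-- Pointed simplicial sets. -/
abbrev PSSet := SimplicialObject Pointed.{u}

instance : HasColimitsOfSize.{0, 0} SSet.{u} := hasColimitsOfSizeShrink.{0, 0, u, u} SSet.{u}

instance : HasColimitsOfSize.{0, 0} PSSet.{u} :=
  inferInstanceAs (HasColimitsOfSize.{0, 0} (SimplexCategoryᵒᵖ ⥤ Pointed.{u}))

/-- The simplicial set underlying a pointed simplicial set. -/
def forgetP : PSSet.{u} ⥤ SSet.{u} :=
  (SimplicialObject.whiskering Pointed.{u} (Type u)).obj (forget Pointed.{u})

/-- Two simplices of `Δ[1]` of the same dimension are identified in the simplicial circle if they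
are equal or both lie in `∂Δ[1]`. -/
def circleSetoid (n : SimplexCategoryᵒᵖ) : Setoid ((Δ[1] : SSet.{u}).obj n) where
  r x y := x = y ∨ x ∈ (∂Δ[1] : SSet.Subcomplex Δ[1]).obj n ∧
    y ∈ (∂Δ[1] : SSet.Subcomplex Δ[1]).obj n
  iseqv := ⟨fun _ => .inl rfl, by
    rintro _ _ (rfl | h)
    · exact .inl rfl
    · exact .inr h.symm, by
    rintro _ _ _ (rfl | h) (rfl | h')
    · exact .inl rfl
    · exact .inr h'
    · exact .inr h
    · exact .inr ⟨h.1, h'.2⟩⟩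

/-- The simplicial circle `S¹ = Δ[1] / ∂Δ[1]`. -/
def circle : PSSet.{u} where
  obj n :=
    { X := Quotient (circleSetoid.{u} n)
      point := Quotient.mk _ (SSet.stdSimplex.const 1 0 n) }
  map {m n} θ :=
    { toFun := Quotient.map ((Δ[1] : SSet.{u}).map θ) (by
        rintro x y (rfl | h)
        · exact .inl rfl
        · exact .inr ⟨(∂Δ[1] : SSet.Subcomplex Δ[1]).map θ h.1,
            (∂Δ[1] : SSet.Subcomplex Δ[1]).map θ h.2⟩)
      map_point := rfl }
  map_id n := pointed_hom_ext fun x => Quotient.inductionOn x fun y =>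
    congrArg (Quotient.mk _) (by simp)
  map_comp θ η := pointed_hom_ext fun x => Quotient.inductionOn x fun y =>
    congrArg (Quotient.mk _) (by simp)

/-- The functor `K ↦ S¹ ∧ K`, formed dimensionwise. -/
def susp : PSSet.{u} ⥤ PSSet.{u} where
  obj K :=
    { obj n := smash (circle.obj n) (K.obj n)
      map θ := smashMap (circle.map θ) (K.map θ)
      map_id n := by
        rw [CategoryTheory.Functor.map_id, CategoryTheory.Functor.map_id]
        exact smash_hom_ext fun _ _ => rfl
      map_comp θ η := by
        rw [CategoryTheory.Functor.map_comp, CategoryTheory.Functor.map_comp]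
        exact smash_hom_ext fun _ _ => rfl }
  map f :=
    { app n := smashMap (𝟙 _) (f.app n)
      naturality m n θ := smash_hom_ext fun a b => by
        exact congrArg (smashMk _ _ _)
          (congrArg (fun t : _ ⟶ _ => Pointed.Hom.toFun t b) (f.naturality θ)) }
  map_id K := by
    refine NatTrans.ext (funext fun n => ?_)
    exact (smashFunctor _).map_id _
  map_comp f g := by
    refine NatTrans.ext (funext fun n => ?_)
    exact (smashFunctor _).map_comp _ _

/-- The diagonal `n ↦ (B_n)_n` of a bisimplicial object. -/
def bisimplicialDiag {C : Type*} [Category* C] :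
    SimplicialObject (SimplicialObject C) ⥤ SimplicialObject C where
  obj B :=
    { obj n := (B.obj n).obj n
      map {m n} θ := (B.map θ).app m ≫ (B.obj n).map θ
      map_id n := by
        rw [CategoryTheory.Functor.map_id, CategoryTheory.Functor.map_id]
        exact Category.comp_id _
      map_comp {l m n} θ η := by
        rw [CategoryTheory.Functor.map_comp, CategoryTheory.Functor.map_comp]
        refine Eq.trans (Category.assoc _ _ _) (Eq.trans ?_ (Category.assoc _ _ _).symm)
        refine congrArg ((B.map θ).app l ≫ ·) ?_
        rw [← Category.assoc, ← Category.assoc]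
        exact congrArg (· ≫ (B.obj n).map η) ((B.map η).naturality θ).symm }
  map {B B'} f :=
    { app n := (f.app n).app n
      naturality m n θ := by
        have h := congrArg (fun t => NatTrans.app t m) (f.naturality θ)
        refine Eq.trans (Category.assoc _ _ _) (Eq.trans ?_ (Category.assoc _ _ _))
        rw [(f.app n).naturality θ, ← Category.assoc]
        exact congrArg (· ≫ (B'.obj n).map θ) h }
  map_id _ := rfl
  map_comp _ _ := rfl

/-- A spectrum: a sequence of pointed simplicial sets with structure maps
`S¹ ∧ E_n ⟶ E_{n+1}`. -/
structure Spectrum where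
  space : ℕ → PSSet.{u}
  bond (n : ℕ) : susp.obj (space n) ⟶ space (n + 1)

namespace Spectrum

/-- A morphism of spectra: a sequence of pointed maps compatible with the structure maps. -/
@[ext]
structure Hom (E F : Spectrum.{u}) where
  app (n : ℕ) : E.space n ⟶ F.space n
  comm (n : ℕ) : E.bond n ≫ app (n + 1) = susp.map (app n) ≫ F.bond n

instance : Category Spectrum.{u} where
  Hom := Hom
  id E := { app n := 𝟙 _, comm n := by simp }
  comp f g :=
    { app n := f.app n ≫ g.app n
      comm n := by
        rw [← Category.assoc, f.comm, Category.assoc, g.comm, CategoryTheory.Functor.map_comp,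
          Category.assoc] }
  id_comp f := Hom.ext (funext fun _ => Category.id_comp _)
  comp_id f := Hom.ext (funext fun _ => Category.comp_id _)
  assoc f g h := Hom.ext (funext fun _ => Category.assoc _ _ _)

/-- The functor `E ↦ E_n`. -/
def level (n : ℕ) : Spectrum.{u} ⥤ PSSet.{u} where
  obj E := E.space n
  map f := f.app n

end Spectrum

/-- Smash product with the circle commutes with colimits. -/
instance (J : Type) [SmallCategory J] : PreservesColimitsOfShape J susp.{u} := by
  have (n : SimplexCategoryᵒᵖ) : PreservesColimitsOfShape J
      ((susp.{u} : (SimplexCategoryᵒᵖ ⥤ Pointed.{u}) ⥤ (SimplexCategoryᵒᵖ ⥤ Pointed.{u})) ⋙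
        (evaluation SimplexCategoryᵒᵖ Pointed.{u}).obj n) :=
    inferInstanceAs (PreservesColimitsOfShape J
      ((evaluation SimplexCategoryᵒᵖ Pointed.{u}).obj n ⋙ smashFunctor (circle.{u}.obj n)))
  exact preservesColimitsOfShape_of_evaluation
    (susp.{u} : (SimplexCategoryᵒᵖ ⥤ Pointed.{u}) ⥤ (SimplexCategoryᵒᵖ ⥤ Pointed.{u})) J this

namespace Spectrum

variable {J : Type} [SmallCategory J] (F : J ⥤ Spectrum.{u})

/-- `S¹ ∧ colim E_n` is the colimit of `S¹ ∧ E_n`. -/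
def suspIsColimit (n : ℕ) :
    IsColimit (susp.mapCocone (colimit.cocone (F ⋙ level n))) :=
  isColimitOfPreserves susp (colimit.isColimit (F ⋙ level n))

/-- The colimit of a diagram of spectra, formed levelwise. -/
def colimSpectrum : Spectrum.{u} where
  space n := colimit (F ⋙ level n)
  bond n := (suspIsColimit F n).desc
    { pt := colimit (F ⋙ level (n + 1))
      ι :=
        { app j := (F.obj j).bond n ≫ colimit.ι (F ⋙ level (n + 1)) j
          naturality j k h := by
            have w := colimit.w (F ⋙ level (n + 1)) h
            refine Eq.trans ?_ (Category.comp_id _).symm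
            rw [← w]
            refine Eq.trans ?_ (Category.assoc _ _ _)
            refine Eq.trans (Category.assoc _ _ _).symm ?_
            exact congrArg (· ≫ colimit.ι (F ⋙ level (n + 1)) k) ((F.map h).comm n).symm } }

lemma ι_bond (n : ℕ) (j : J) :
    susp.map (colimit.ι (F ⋙ level n) j) ≫ (colimSpectrum F).bond n =
      (F.obj j).bond n ≫ colimit.ι (F ⋙ level (n + 1)) j :=
  (suspIsColimit F n).fac _ j

/-- The colimit cocone of a diagram of spectra. -/
def colimCocone : Cocone F where
  pt := colimSpectrum F
  ι :=
    { app j := { app n := colimit.ι (F ⋙ level n) j, comm n := (ι_bond F n j).symm }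
      naturality _ _ h := Hom.ext (funext fun n =>
        (colimit.w (F ⋙ level n) h).trans (Category.comp_id _).symm) }

/-- It is a colimit. -/
def colimCoconeIsColimit : IsColimit (colimCocone F) where
  desc s :=
    { app n := colimit.desc (F ⋙ level n) ((level n).mapCocone s)
      comm n := (suspIsColimit F n).hom_ext fun j => by
        have h₁ : colimit.ι (F ⋙ level n) j ≫ colimit.desc (F ⋙ level n) ((level n).mapCocone s) =
            (s.ι.app j).app n := colimit.ι_desc ((level n).mapCocone s) j
        have h₂ : colimit.ι (F ⋙ level (n + 1)) j ≫ colimit.desc (F ⋙ level (n + 1))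
            ((level (n + 1)).mapCocone s) = (s.ι.app j).app (n + 1) :=
          colimit.ι_desc ((level (n + 1)).mapCocone s) j
        refine (Category.assoc _ _ _).symm.trans ?_
        refine (congrArg (· ≫ colimit.desc (F ⋙ level (n + 1))
          ((level (n + 1)).mapCocone s)) (ι_bond F n j)).trans ?_
        refine (Category.assoc _ _ _).trans ?_
        refine (congrArg ((F.obj j).bond n ≫ ·) h₂).trans ?_
        refine ((s.ι.app j).comm n).trans ?_
        refine (congrArg (fun t => susp.map t ≫ s.pt.bond n) h₁.symm).trans ?_
        refine (congrArg (· ≫ s.pt.bond n) (susp.map_comp _ _)).trans ?_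
        exact Category.assoc _ _ _ }
  fac s j := Hom.ext (funext fun n => colimit.ι_desc ((level n).mapCocone s) j)
  uniq s m hm := Hom.ext (funext fun n => colimit.hom_ext fun j => by
    refine Eq.trans ?_ (colimit.ι_desc ((level n).mapCocone s) j).symm
    exact congrArg (fun t : F.obj j ⟶ s.pt => t.app n) (hm j))

instance : HasColimitsOfSize.{0, 0} Spectrum.{u} :=
  ⟨fun _ _ => ⟨fun F => ⟨⟨⟨_, colimCoconeIsColimit F⟩⟩⟩⟩⟩

/-- The diagonal of a simplicial spectrum, formed levelwise, with structure maps
`(S¹)_p ∧ ((B_p)_n)_p ⟶ ((B_p)_{n+1})_p`. -/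
def diagonal : SimplicialObject Spectrum.{u} ⥤ Spectrum.{u} where
  obj B :=
    { space n := bisimplicialDiag.obj (((SimplicialObject.whiskering _ _).obj (level n)).obj B)
      bond n :=
        { app p := ((B.obj p).bond n).app p
          naturality p q θ := by
            have h₀ : smashMap (circle.map θ) (((B.map θ).app n).app p ≫
                ((B.obj q).space n).map θ) = (susp.map ((B.map θ).app n)).app p ≫
                  (susp.obj ((B.obj q).space n)).map θ := smash_hom_ext fun _ _ => rfl
            have h₁ : ((B.obj p).bond n).app p ≫ ((B.map θ).app (n + 1)).app p =
                (susp.map ((B.map θ).app n)).app p ≫ ((B.obj q).bond n).app p :=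
              congrArg (fun t => NatTrans.app t p) ((B.map θ).comm n)
            have h₂ := ((B.obj q).bond n).naturality θ
            refine (congrArg (· ≫ ((B.obj q).bond n).app q) h₀).trans ?_
            refine (Category.assoc _ _ _).trans ?_
            refine (congrArg ((susp.map ((B.map θ).app n)).app p ≫ ·) h₂).trans ?_
            refine (Category.assoc _ _ _).symm.trans ?_
            refine (congrArg (· ≫ ((B.obj q).space (n + 1)).map θ) h₁.symm).trans ?_
            exact Category.assoc _ _ _ } }
  map f :=
    { app n := bisimplicialDiag.map (((SimplicialObject.whiskering _ _).obj (level n)).map f)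
      comm n := by
        refine NatTrans.ext (funext fun p => ?_)
        have h := congrArg (fun t => NatTrans.app t p) ((f.app p).comm n)
        exact h }
  map_id _ := rfl
  map_comp _ _ := rfl

end Spectrum


section WeakEquivalence

/-- The map induced by a continuous map on based loops of dimension `n`. -/
def genLoopMap {X Y : Type*} [TopologicalSpace X] [TopologicalSpace Y] (f : C(X, Y)) {N : Type*}
    {x : X} {y : Y} (h : f x = y) (α : GenLoop N X x) : GenLoop N Y y :=
  ⟨f.comp α.1, fun t ht => (congrArg f (α.2 t ht)).trans h⟩

/-- The map `π_n(X, x) → π_n(Y, y)` induced by a continuous map with `f x = y`. -/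
def piMap {X Y : Type*} [TopologicalSpace X] [TopologicalSpace Y] (f : C(X, Y)) (n : ℕ)
    {x : X} {y : Y} (h : f x = y) : π_ n X x → π_ n Y y :=
  Quotient.map (genLoopMap f h) (by
    rintro α β ⟨H⟩
    refine ⟨⟨⟨f.comp H.toContinuousMap, fun t => ?_, fun t => ?_⟩, fun s t ht => ?_⟩⟩
    · exact congrArg f (H.apply_zero t)
    · exact congrArg f (H.apply_one t)
    · exact congrArg f (H.prop s t ht))

/-- The map on sets of path components. -/
def pi0Map {X Y : Type*} [TopologicalSpace X] [TopologicalSpace Y] (f : C(X, Y)) :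
    ZerothHomotopy X → ZerothHomotopy Y :=
  ZerothHomotopy.lift (fun x => ZerothHomotopy.mk (f x)) fun _ _ p =>
    ZerothHomotopy.sound (p.map f.continuous)

/-- The continuous map `|f| : |K| → |L|` of geometric realizations. -/
abbrev realize {K L : SSet.{u}} (f : K ⟶ L) : C(SSet.toTop.obj K, SSet.toTop.obj L) :=
  (SSet.toTop.map f).hom

/-- A map of simplicial sets is a weak equivalence if its geometric realization is a weak homotopy
equivalence: a bijection on path components and on all homotopy groups at all base points. -/
def SSetWeq {K L : SSet.{u}} (f : K ⟶ L) : Prop :=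
  Function.Bijective (pi0Map (realize f)) ∧
    ∀ (n : ℕ) (x : SSet.toTop.obj K),
      Function.Bijective (piMap (realize f) (n + 1) (x := x) rfl)

/-- A map of pointed simplicial sets is a weak equivalence if the underlying map of simplicial
sets is. -/
def PSSetWeq {K L : PSSet.{u}} (f : K ⟶ L) : Prop :=
  SSetWeq (forgetP.map f)

/-- The point of `|K|` given by a vertex of `K`. -/
def vertex (K : SSet.{u}) (x : K.obj (op ⦋0⦌)) : SSet.toTop.obj K :=
  TopCat.toSSetObj₀Equiv ((sSetTopAdj.unit.app K).app _ x)

/-- The geometric realization of a pointed simplicial set. -/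
abbrev geomReal (K : PSSet.{u}) : TopCat.{u} := SSet.toTop.obj (forgetP.obj K)

/-- The base point of `|K|`. -/
def basePt (K : PSSet.{u}) : geomReal K := vertex (forgetP.obj K) (K.obj (op ⦋0⦌)).point

lemma realize_comp {K L N : SSet.{u}} (f : K ⟶ L) (g : L ⟶ N) (x : SSet.toTop.obj K) :
    realize g (realize f x) = realize (f ≫ g) x :=
  (congrArg (fun t : SSet.toTop.obj K ⟶ SSet.toTop.obj N => t.hom x)
    (SSet.toTop.map_comp f g)).symm

lemma realize_vertex {K L : SSet.{u}} (f : K ⟶ L) (x : K.obj (op ⦋0⦌)) :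
    realize f (vertex K x) = vertex L (f.app _ x) :=
  (congrArg (fun t : K ⟶ TopCat.toSSet.obj (SSet.toTop.obj L) =>
    TopCat.toSSetObj₀Equiv (t.app _ x)) (sSetTopAdj.unit.naturality f)).symm

lemma realize_basePt {K L : PSSet.{u}} (f : K ⟶ L) :
    realize (forgetP.map f) (basePt K) = basePt L :=
  (realize_vertex _ _).trans (congrArg (vertex _) (f.app (op ⦋0⦌)).map_point)

open MonoidalCategory CartesianMonoidalCategory

/-- The quotient map `Δ[1] × K ⟶ S¹ ∧ K`. -/
def toSusp (K : PSSet.{u}) : Δ[1] ⊗ forgetP.obj K ⟶ forgetP.obj (susp.obj K) where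
  app n := ↾fun p => smashMk (circle.obj n) (K.obj n) (Quotient.mk _ p.1) p.2
  naturality _ _ _ := rfl

namespace Spectrum

/-- `IsSusp α β` says that `β : I^(m+1) → |E_{n+1}|` is the suspension of `α : I^m → |E_n|`
followed by the structure map: `β` is the composite of
`I × I^m → |Δ[1]| × |E_n| ≅ |Δ[1] × E_n|`, `(s, t) ↦ (s, α t)`, with
`|Δ[1] × E_n| → |S¹ ∧ E_n| → |E_{n+1}|`. -/
def IsSusp (E : Spectrum.{u}) {n m : ℕ} (α : GenLoop (Fin m) (geomReal (E.space n)) (basePt _))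
    (β : GenLoop (Fin (m + 1)) (geomReal (E.space (n + 1))) (basePt _)) : Prop :=
  ∃ γ : C(Fin (m + 1) → unitInterval, SSet.toTop.obj (Δ[1] ⊗ forgetP.obj (E.space n))),
    (∀ t, (SimplexCategory.toTopHomeo ⦋1⦌ (realize (fst _ _) (γ t))).1 1 = t 0) ∧
    (∀ t, realize (snd _ _) (γ t) = α.1 (Fin.tail t)) ∧
    (∀ t, β.1 t = realize (toSusp _ ≫ forgetP.map (E.bond n)) (γ t))

/-- The disjoint union of the homotopy sets `π_m(E_n)` over all `m`, `n` with `m - n = k`. -/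
def PreStable (E : Spectrum.{u}) (k : ℤ) : Type u :=
  Σ p : {p : ℕ × ℕ // (p.2 : ℤ) = k + p.1}, π_ p.1.2 (geomReal (E.space p.1.1)) (basePt _)

/-- The identifications along the maps `π_m(E_n) → π_{m+1}(S¹ ∧ E_n) → π_{m+1}(E_{n+1})`. -/
inductive StableRel (E : Spectrum.{u}) (k : ℤ) : PreStable E k → PreStable E k → Prop where
  | intro (n m : ℕ) (h : (m : ℤ) = k + n) (h' : ((m + 1 : ℕ) : ℤ) = k + (n + 1 : ℕ))
      (α : GenLoop (Fin m) (geomReal (E.space n)) (basePt _))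
      (β : GenLoop (Fin (m + 1)) (geomReal (E.space (n + 1))) (basePt _)) (hαβ : IsSusp E α β) :
      StableRel E k ⟨⟨(n, m), h⟩, Quotient.mk _ α⟩ ⟨⟨(n + 1, m + 1), h'⟩, Quotient.mk _ β⟩

/-- The stable homotopy group `π_k(E) = colim_n π_{n+k}(E_n)`, `k ∈ ℤ`, as a set. -/
def StablePi (E : Spectrum.{u}) (k : ℤ) : Type u := Quot (StableRel E k)

lemma IsSusp.map {E F : Spectrum.{u}} (f : E ⟶ F) {n m : ℕ}
    {α : GenLoop (Fin m) (geomReal (E.space n)) (basePt _)}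
    {β : GenLoop (Fin (m + 1)) (geomReal (E.space (n + 1))) (basePt _)} (h : IsSusp E α β) :
    IsSusp F (genLoopMap (realize (forgetP.map (f.app n))) (realize_basePt _) α)
      (genLoopMap (realize (forgetP.map (f.app (n + 1)))) (realize_basePt _) β) := by
  obtain ⟨γ, h₁, h₂, h₃⟩ := h
  let g := forgetP.map (f.app n)
  refine ⟨(realize (Δ[1] ◁ g)).comp γ, fun t => ?_, fun t => ?_, fun t => ?_⟩
  · refine Eq.trans ?_ (h₁ t)
    refine congrArg (fun z => (SimplexCategory.toTopHomeo ⦋1⦌ z).1 1) ?_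
    exact (realize_comp _ _ _).trans (congrArg (realize · (γ t)) (whiskerLeft_fst _ _))
  · refine (realize_comp _ _ _).trans ?_
    rw [whiskerLeft_snd, ← realize_comp, h₂]
    rfl
  · refine Eq.trans ?_ (realize_comp _ _ _).symm
    refine (congrArg (realize _) (h₃ t)).trans ?_
    refine (realize_comp _ _ _).trans (congrArg (realize · (γ t)) ?_)
    have h : Δ[1] ◁ g ≫ toSusp (F.space n) =
        toSusp (E.space n) ≫ forgetP.map (susp.map (f.app n)) := rfl
    rw [← Category.assoc, h, Category.assoc, Category.assoc,
      ← CategoryTheory.Functor.map_comp, ← CategoryTheory.Functor.map_comp]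
    exact congrArg (fun t => toSusp (E.space n) ≫ forgetP.map t) (f.comm n)

/-- The map induced on stable homotopy groups. -/
def stableMap {E F : Spectrum.{u}} (f : E ⟶ F) (k : ℤ) : StablePi E k → StablePi F k :=
  Quot.map (fun z => ⟨z.1, piMap (realize (forgetP.map (f.app z.1.1.1))) z.1.1.2
    (realize_basePt _) z.2⟩) (by
      rintro _ _ ⟨n, m, h, h', α, β, hαβ⟩
      exact .intro n m h h' _ _ (hαβ.map f))

/-- A map of spectra is a weak equivalence if it induces isomorphisms on all stable homotopy
groups. -/
def Weq {E F : Spectrum.{u}} (f : E ⟶ F) : Prop :=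
  ∀ k : ℤ, Function.Bijective (stableMap f k)

end Spectrum

end WeakEquivalence

section SemiTopologization

/-- The semi-topologization of a presheaf of simplicial sets: `X` is sent to the diagonal of
the bisimplicial set `n ↦ E(Δⁿ_top × X)`. -/
def sstSSet (E : SchCᵒᵖ ⥤ SSet.{u}) : SchCᵒᵖ ⥤ SSet.{u} :=
  sst (M := SSet.{u}) (bisimplicialDiag (C := Type u)) E

/-- The semi-topologization of a presheaf of pointed simplicial sets. -/
def sstPSSet (E : SchCᵒᵖ ⥤ PSSet.{u}) : SchCᵒᵖ ⥤ PSSet.{u} :=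
  sst (M := PSSet.{u}) (bisimplicialDiag (C := Pointed.{u})) E

/-- The semi-topologization of a presheaf of spectra. -/
def sstSpectrum (E : SchCᵒᵖ ⥤ Spectrum.{u}) : SchCᵒᵖ ⥤ Spectrum.{u} :=
  sst (M := Spectrum.{u}) Spectrum.diagonal E

end SemiTopologization

end

end SemiTop

/-! The affine line contracts onto its origin by scaling, `(s, t) ↦ st`. After semi-topologization
the parameter `s` may be any continuous function, so this contraction gives an honest simplicial
homotopy, with no hypothesis on `E`.

Let `α : T → ℂ` be continuous. A class in `E(T × 𝔸¹ × X)` represented over `(f, U)` is pulled back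
along `(u, s, t, x) ↦ (u, st, x)` and regarded as a class over `((f, α), U × 𝔸¹)`. This is `act E α
X`. It makes sense because `U × 𝔸¹` is again reduced and `t ↦ (f t, α t)` is continuous for the
analytic topology (`continuous_pairPt`). The action is natural in `T` (`valueMap_act`) and fixes
classes pulled back from `X` (`valueMap_snd_act`). For constant `α = c` the map `(f, c)` factors
through the section `U → U × 𝔸¹` at `c`, so the colimit relation turns the action into pullback
along scaling by `c` (`act_const`): the identity for `c = 1`, and the zero section after the
projection for `c = 0`.

An `n`-simplex of `Δ[1]` is an affine map `Δⁿ → Δ¹`; its coordinate at vertex `0` is a function on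
`Δⁿ`. Acting by these functions defines a homotopy on the diagonal from the identity to `π^*`
composed with restriction to the zero section, stationary on the image of `π^*`.

To pass to homotopy groups, the simplicial homotopy is realized topologically. Only the
homeomorphism `|Δ[n] × Δ[1]| ≅ Δⁿ × Δ¹` is needed; by currying, it is glued over the simplices of an
arbitrary simplicial set (`exists_realization_prism`). Since the homotopy is stationary on the image
of `π^*`, base points do not move, and for spectra a levelwise argument suffices. -/

namespace SemiTop

noncomputable section

open scoped Simplicial Topology Topology.Homotopy
open MonoidalCategory CartesianMonoidalCategory

/-! ### Points of, and continuous maps out of, a geometric realization -/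

section Realization

/-- The point of `|K|` with coordinates `a` in the simplex `x`. -/
def simplexPt (K : SSet.{u}) {m : SimplexCategory} (x : K.obj (op m))
    (a : stdSimplex ℝ (Fin (m.len + 1))) : SSet.toTop.obj K :=
  SSet.toTop.map (SSet.yonedaEquiv.symm x) (m.toTopHomeo.symm a)

lemma continuous_simplexPt (K : SSet.{u}) {m : SimplexCategory} (x : K.obj (op m)) :
    Continuous (simplexPt K x) :=
  (SSet.toTop.map (SSet.yonedaEquiv.symm x)).hom.continuous.comp m.toTopHomeo.symm.continuous

lemma realize_simplexPt {K L : SSet.{u}} (f : K ⟶ L) {m : SimplexCategory} (x : K.obj (op m))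
    (a : stdSimplex ℝ (Fin (m.len + 1))) :
    realize f (simplexPt K x a) = simplexPt L (f.app _ x) a := by
  refine (realize_comp _ _ _).trans ?_
  rw [SSet.yonedaEquiv_symm_comp]
  rfl

lemma simplexPt_map (K : SSet.{u}) {m m' : SimplexCategory} (θ : m' ⟶ m) (x : K.obj (op m))
    (a : stdSimplex ℝ (Fin (m'.len + 1))) :
    simplexPt K (K.map θ.op x) a = simplexPt K x (stdSimplex.map θ a) := by
  unfold simplexPt
  rw [SimplexCategory.toTopHomeo_symm_naturality_apply]
  refine Eq.trans ?_ (realize_comp _ _ _).symm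
  rw [SSet.yonedaEquiv_symm_naturality_left]

lemma toTopHomeo_simplexPt {n m : SimplexCategory} (x : (SSet.stdSimplex.{u}.obj n).obj (op m))
    (a : stdSimplex ℝ (Fin (m.len + 1))) :
    n.toTopHomeo (simplexPt _ x a) = stdSimplex.map (SSet.stdSimplex.objEquiv x) a := by
  have h : SSet.yonedaEquiv.symm x = SSet.stdSimplex.map (SSet.stdSimplex.objEquiv x) := by
    rw [Equiv.symm_apply_eq, SSet.yonedaEquiv_map, Equiv.symm_apply_apply]
  unfold simplexPt
  rw [h]
  refine (SimplexCategory.toTopHomeo_naturality_apply _ _).trans ?_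
  rw [Homeomorph.apply_symm_apply]

/-- Expresses the adjunction between realization and singular complex in barycentric coordinates, so
that maps out of `|K|` can be compared and constructed simplex by simplex. -/
lemma homEquiv_apply_simplex {K : SSet.{u}} {Z : TopCat.{u}} (g : SSet.toTop.obj K ⟶ Z)
    {m : SimplexCategory} (x : K.obj (op m)) (a : stdSimplex ℝ (Fin (m.len + 1))) :
    TopCat.toSSetObjEquiv Z (op m) ((sSetTopAdj.homEquiv K Z g).app _ x) a =
      g (simplexPt K x a) := by
  rw [Adjunction.homEquiv_unit]
  have h := sSetTopAdj_unit_app_app_down K (op m) x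
  have h' := congrArg (fun t => g (t.hom (ULift.up a))) h
  exact h'

lemma realization_hom_ext {K : SSet.{u}} {Z : TopCat.{u}} {g g' : SSet.toTop.obj K ⟶ Z}
    (h : ∀ (m : SimplexCategory) (x : K.obj (op m)) a, g (simplexPt K x a) = g' (simplexPt K x a)) :
    g = g' := by
  refine (sSetTopAdj.homEquiv K Z).injective ?_
  ext ⟨m⟩ x
  refine (TopCat.toSSetObjEquiv Z (op m)).injective (ContinuousMap.ext fun a => ?_)
  exact (homEquiv_apply_simplex g x a).trans ((h m x a).trans (homEquiv_apply_simplex g' x a).symm)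

/-- Every map into an indiscrete space is continuous. The indicator of the set of points of the form
`simplexPt`, with values in the two-element set `Set PUnit`, agrees with the constant function
`univ` on every simplex, hence everywhere by `realization_hom_ext`. -/
lemma exists_simplexPt {K : SSet.{u}} (y : SSet.toTop.obj K) :
    ∃ (m : SimplexCategory) (x : K.obj (op m)) (a : _), simplexPt K x a = y := by
  let _ : TopologicalSpace (Set PUnit.{u + 1}) := ⊤
  let g : SSet.toTop.obj K ⟶ TopCat.of (Set PUnit.{u + 1}) := TopCat.ofHom
    ⟨fun y => {_z | ∃ (m : SimplexCategory) (x : K.obj (op m)) (a : _), simplexPt K x a = y},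
      continuous_top⟩
  let g' : SSet.toTop.obj K ⟶ TopCat.of (Set PUnit.{u + 1}) :=
    TopCat.ofHom ⟨fun _ => Set.univ, continuous_top⟩
  have h : g = g' := realization_hom_ext fun m x a =>
    Set.eq_univ_of_forall fun _ => ⟨m, x, a, rfl⟩
  have h' : g y = g' y := by rw [h]
  exact (Set.ext_iff.1 h' PUnit.unit).2 trivial

/-- Continuous maps out of `|K|` are compatible families of continuous maps on its simplices. -/
lemma exists_realization_desc {K : SSet.{u}} {Z : TopCat.{u}}
    (c : ∀ {m : SimplexCategory}, K.obj (op m) → C(stdSimplex ℝ (Fin (m.len + 1)), Z))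
    (hc : ∀ {m m' : SimplexCategory} (θ : m' ⟶ m) (x : K.obj (op m)) a,
      c (K.map θ.op x) a = c x (stdSimplex.map θ a)) :
    ∃ g : C(SSet.toTop.obj K, Z), ∀ {m : SimplexCategory} (x : K.obj (op m)) a,
      g (simplexPt K x a) = c x a := by
  let φ : K ⟶ TopCat.toSSet.obj Z :=
    { app m := ↾fun x => (TopCat.toSSetObjEquiv Z m).symm (c (m := m.unop) x)
      naturality m m' θ := by
        ext x
        refine (TopCat.toSSetObjEquiv Z m').injective (ContinuousMap.ext fun a => ?_)
        refine (congrArg (fun t : C(_, Z) => t a) (Equiv.apply_symm_apply _ _)).trans ?_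
        exact hc θ.unop x a }
  refine ⟨((sSetTopAdj.homEquiv K Z).symm φ).hom, fun {m} x a => ?_⟩
  refine (homEquiv_apply_simplex _ x a).symm.trans ?_
  rw [Equiv.apply_symm_apply]
  rfl

end Realization

/-! ### The homeomorphism `|Δ[n] × Δ[1]| ≅ Δⁿ × Δ¹` -/

section Prism

/-- The sum of the first `k` barycentric coordinates. -/
def partialSum {N : ℕ} (a : stdSimplex ℝ (Fin N)) (k : ℕ) : ℝ := ∑ l with l.val < k, a l

lemma partialSum_mono {N : ℕ} (a : stdSimplex ℝ (Fin N)) : Monotone (partialSum a) :=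
  fun _ _ h => Finset.sum_le_sum_of_subset_of_nonneg
    (Finset.monotone_filter_right _ fun _ _ hx => hx.trans_le h) fun l _ _ => a.2.1 l

lemma partialSum_zero {N : ℕ} (a : stdSimplex ℝ (Fin N)) : partialSum a 0 = 0 := by
  simp [partialSum]

lemma partialSum_of_le {N k : ℕ} (a : stdSimplex ℝ (Fin N)) (h : N ≤ k) : partialSum a k = 1 := by
  unfold partialSum
  rw [Finset.filter_true_of_mem fun l _ => l.2.trans_le h]
  exact a.2.2

lemma partialSum_succ {N : ℕ} (a : stdSimplex ℝ (Fin N)) (l : Fin N) :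
    partialSum a (l + 1) = partialSum a l + a l := by
  unfold partialSum
  have : (Finset.univ.filter fun x : Fin N => x.val < l + 1) =
      insert l (Finset.univ.filter fun x : Fin N => x.val < l) := by
    ext x
    simp only [Finset.mem_filter, Finset.mem_univ, true_and, Finset.mem_insert, Fin.ext_iff]
    omega
  rw [this, Finset.sum_insert (by simp), add_comm]

lemma partialSum_ext {N : ℕ} {a b : stdSimplex ℝ (Fin N)}
    (h : ∀ k, partialSum a k = partialSum b k) : a = b := by
  ext l
  have h₁ := partialSum_succ a l
  rw [h, h, partialSum_succ b l] at h₁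
  linarith

lemma stdSimplex_map_apply {N N' : ℕ} (f : Fin N → Fin N') (a : stdSimplex ℝ (Fin N))
    (y : Fin N') : stdSimplex.map f a y = ∑ x with f x = y, a x := by
  rw [stdSimplex.map_coe, FunOnFinite.linearMap_apply_apply]

lemma partialSum_map {N N' : ℕ} (f : Fin N → Fin N') (a : stdSimplex ℝ (Fin N)) (k : ℕ) :
    partialSum (stdSimplex.map f a) k = ∑ x with (f x).val < k, a x := by
  unfold partialSum
  simp_rw [stdSimplex_map_apply]
  rw [← Finset.sum_fiberwise_of_maps_to (g := f) (t := Finset.univ.filter fun y => y.val < k)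
    (fun x hx => by simpa using hx)]
  refine Finset.sum_congr rfl fun y hy => Finset.sum_congr ?_ fun _ _ => rfl
  ext x
  simp only [Finset.mem_filter, Finset.mem_univ, true_and] at hy ⊢
  exact ⟨fun h => ⟨h ▸ hy, h⟩, fun h => h.2⟩

lemma stdSimplex_map_congr {N N' : ℕ} {f g : Fin N → Fin N'} {a : stdSimplex ℝ (Fin N)}
    (h : ∀ x, a x ≠ 0 → f x = g x) : stdSimplex.map f a = stdSimplex.map g a := by
  ext y
  rw [stdSimplex_map_apply, stdSimplex_map_apply, Finset.sum_filter, Finset.sum_filter]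
  refine Finset.sum_congr rfl fun x _ => ?_
  by_cases hx : a x = 0
  · simp [hx]
  · rw [h x hx]

/-- A monotone function with values from `0` to `1` is a function of partial sums. -/
lemma exists_partialSum_eq {N : ℕ} {A : ℕ → ℝ} (hA : Monotone A) (h₀ : A 0 = 0) (h₁ : A N = 1) :
    ∃ a : stdSimplex ℝ (Fin N), ∀ k ≤ N, partialSum a k = A k := by
  refine ⟨⟨fun l => A (l + 1) - A l, fun l => sub_nonneg.2 (hA (Nat.le_succ _)), ?_⟩, ?_⟩
  · rw [Fin.sum_univ_eq_sum_range (fun l => A (l + 1) - A l), Finset.sum_range_sub, h₀, h₁,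
      sub_zero]
  · intro k
    induction k with
    | zero => intro _; rw [partialSum_zero, h₀]
    | succ k ih =>
      intro hk
      refine (partialSum_succ _ (⟨k, hk⟩ : Fin N)).trans ?_
      rw [ih (by omega)]
      exact add_sub_cancel _ _

/-- The `i`-th simplex of dimension `n + 1` of the prism `Δ[n] × Δ[1]`. -/
def prismSimplex {n : ℕ} (i : Fin (n + 1)) :
    (SSet.stdSimplex.{u}.obj ⦋n⦌ ⊗ SSet.stdSimplex.{u}.obj ⦋1⦌).obj (op ⦋n + 1⦌) :=
  (SSet.stdSimplex.objEquiv.symm (SimplexCategory.σ i), SSet.stdSimplex.objMk₁ i.succ.castSucc)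

/-- The degeneracy `σ i` pulls initial segments back to initial segments, one element longer once
they contain `i`. Hence pushing forward along it only reindexes partial sums. -/
lemma predAbove_lt_iff {n k : ℕ} (i : Fin (n + 1)) (l : Fin (n + 2)) :
    (i.predAbove l).val < k ↔ l.val < (if k ≤ i then k else k + 1) := by
  rcases le_or_gt l i.castSucc with h | h
  · rw [Fin.predAbove_of_le_castSucc _ _ h, Fin.coe_castPred]
    simp only [Fin.le_def, Fin.val_castSucc] at h
    split_ifs <;> omega
  · rw [Fin.predAbove_of_castSucc_lt _ _ h, Fin.val_pred]
    simp only [Fin.lt_def, Fin.val_castSucc] at h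
    split_ifs <;> omega

/-- The map `|Δ[n] × Δ[1]| → Δⁿ × Δ¹`. -/
def prismProj (n : ℕ) (y : SSet.toTop.obj
    (SSet.stdSimplex.{u}.obj ⦋n⦌ ⊗ SSet.stdSimplex.{u}.obj ⦋1⦌)) :
    stdSimplex ℝ (Fin (n + 1)) × stdSimplex ℝ (Fin 2) :=
  (SimplexCategory.toTopHomeo ⦋n⦌ (realize (fst _ _) y),
    SimplexCategory.toTopHomeo ⦋1⦌ (realize (snd _ _) y))

lemma continuous_prismProj (n : ℕ) : Continuous (prismProj.{u} n) :=
  ((SimplexCategory.toTopHomeo ⦋n⦌).continuous.comp (realize _).continuous).prodMk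
    ((SimplexCategory.toTopHomeo ⦋1⦌).continuous.comp (realize _).continuous)

lemma prismProj_simplexPt {n : ℕ} {m : SimplexCategory}
    (x : (SSet.stdSimplex.{u}.obj ⦋n⦌ ⊗ SSet.stdSimplex.{u}.obj ⦋1⦌).obj (op m)) (a) :
    prismProj n (simplexPt _ x a) =
      (stdSimplex.map (SSet.stdSimplex.objEquiv x.1) a,
        stdSimplex.map (SSet.stdSimplex.objEquiv x.2) a) := by
  refine Prod.ext ?_ ?_
  · refine (congrArg (SimplexCategory.toTopHomeo ⦋n⦌) (realize_simplexPt _ _ _)).trans ?_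
    exact toTopHomeo_simplexPt _ _
  · refine (congrArg (SimplexCategory.toTopHomeo ⦋1⦌) (realize_simplexPt _ _ _)).trans ?_
    exact toTopHomeo_simplexPt _ _

/-- Write `T k` for the partial sums of the `Δⁿ` coordinate and `S` for the first coordinate in
`Δ¹`. On the `i`-th prism simplex the partial sums of `a` are `T 1, …, T i, S, T (i + 1), …, T n`:
that simplex is the region `T i ≤ S ≤ T (i + 1)`, and `a` records `T` with `S` inserted at place `i
+ 1`. Bijectivity of `prismProj` rests on this description. -/
lemma partialSum_prism_fst {n : ℕ} (i : Fin (n + 1)) (a : stdSimplex ℝ (Fin (n + 2))) (k : ℕ) :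
    partialSum (prismProj.{u} n (simplexPt _ (prismSimplex i) a)).1 k =
      partialSum a (if k ≤ i then k else k + 1) := by
  rw [prismProj_simplexPt]
  refine (partialSum_map _ _ _).trans ?_
  refine Finset.sum_congr (Finset.filter_congr fun l _ => ?_) fun _ _ => rfl
  exact predAbove_lt_iff i l

lemma partialSum_prism_snd {n : ℕ} (i : Fin (n + 1)) (a : stdSimplex ℝ (Fin (n + 2))) :
    partialSum (prismProj.{u} n (simplexPt _ (prismSimplex i) a)).2 1 = partialSum a (i + 1) := by
  rw [prismProj_simplexPt]
  refine (partialSum_map _ _ _).trans ?_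
  refine Finset.sum_congr (Finset.filter_congr fun l _ => ?_) fun _ _ => rfl
  have h := SSet.stdSimplex.objMk₁_apply_eq_zero_iff.{u} i.succ.castSucc l
  rw [Nat.lt_one_iff]
  refine Iff.trans ?_ (h.trans ?_)
  · exact (Fin.ext_iff (a := SSet.stdSimplex.objMk₁.{u} i.succ.castSucc l) (b := 0)).symm
  · simp [Fin.lt_def]

lemma exists_eq_map_prismSimplex {n m : ℕ}
    (x : (SSet.stdSimplex.{u}.obj ⦋n⦌ ⊗ SSet.stdSimplex.{u}.obj ⦋1⦌).obj (op ⦋m⦌)) :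
    ∃ (i : Fin (n + 1)) (ρ : ⦋m⦌ ⟶ ⦋n + 1⦌),
      x = (SSet.stdSimplex.{u}.obj ⦋n⦌ ⊗ SSet.stdSimplex.{u}.obj ⦋1⦌).map ρ.op
        (prismSimplex i) := by
  obtain ⟨x₁, x₂⟩ := x
  -- A simplex is a chain in `[n] × [1]`; `i` separates the first coordinates at level `0` from
  -- those at level `1`. If level `0` is empty, `0` works; otherwise take the first coordinate of
  -- the last vertex at level `0`.
  obtain ⟨i, hi⟩ : ∃ i : Fin (n + 1), ∀ k : Fin (m + 1),
      (x₂ k = 0 → x₁ k ≤ i) ∧ (x₂ k = 1 → i ≤ x₁ k) := by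
    obtain ⟨j, rfl⟩ := SSet.stdSimplex.objMk₁_surjective x₂
    have hmono := SSet.stdSimplex.monotone_apply x₁
    have h₀ (k : Fin (m + 1)) := SSet.stdSimplex.objMk₁_apply_eq_zero_iff.{u} j k
    have h₁ (k : Fin (m + 1)) := SSet.stdSimplex.objMk₁_apply_eq_one_iff.{u} j k
    obtain rfl | ⟨j, rfl⟩ := Fin.eq_zero_or_eq_succ j
    · exact ⟨0, fun k => ⟨fun h => absurd ((h₀ k).1 h) (Fin.not_lt_zero _), fun _ => Fin.zero_le _⟩⟩
    · refine ⟨x₁ j, fun k => ⟨fun h => hmono ?_, fun h => hmono ?_⟩⟩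
      · have := (h₀ k).1 h
        simp only [Fin.lt_def, Fin.le_def, Fin.val_castSucc, Fin.val_succ] at this ⊢
        omega
      · have := (h₁ k).1 h
        simp only [Fin.le_def, Fin.val_castSucc, Fin.val_succ] at this ⊢
        omega
  have hx₂ : ∀ k : Fin (m + 1), x₂ k = 0 ∨ x₂ k = 1 := fun k => by
    have h : (x₂ k).val < 2 := (x₂ k).2
    simp only [Fin.ext_iff]
    change (x₂ k).val = 0 ∨ (x₂ k).val = 1
    omega
  -- The `i`-th prism simplex is the path `(0,0), …, (i,0), (i,1), …, (n,1)`. In it `(a, 0)` has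
  -- index `a` and `(a, 1)` has index `a + 1`.
  let r : Fin (m + 1) →o Fin (n + 1 + 1) :=
    { toFun k := if x₂ k = 0 then (x₁ k).castSucc else (x₁ k).succ
      monotone' k l h := by
        have h₁ := SSet.stdSimplex.monotone_apply x₁ h
        have h₂ : x₂ k ≤ x₂ l := SSet.stdSimplex.monotone_apply x₂ h
        have h₃ : (x₁ k).val ≤ (x₁ l).val := h₁
        rcases hx₂ k with hk | hk <;> rcases hx₂ l with hl | hl
        · simp only [hk, hl, if_true, Fin.le_def, Fin.val_castSucc]; exact h₃
        · simp only [hk, hl, if_true, one_ne_zero, if_false, Fin.le_def, Fin.val_castSucc,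
            Fin.val_succ]
          omega
        · rw [hk, hl] at h₂; exact absurd h₂ (by decide)
        · simp only [hk, hl, one_ne_zero, if_false, Fin.le_def, Fin.val_succ]
          omega }
  have hr₀ (k : Fin (m + 1)) (hk : x₂ k = 0) : r k = (x₁ k).castSucc := if_pos hk
  have hr₁ (k : Fin (m + 1)) (hk : x₂ k = 1) : r k = (x₁ k).succ := if_neg (by rw [hk]; decide)
  refine ⟨i, SimplexCategory.Hom.mk r, Prod.ext ?_ ?_⟩
  · refine SSet.stdSimplex.ext _ _ fun k => ?_
    change x₁ k = i.predAbove (r k)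
    rcases hx₂ k with hk | hk
    · rw [hr₀ k hk, Fin.predAbove_castSucc_of_le _ _ ((hi k).1 hk)]
    · rw [hr₁ k hk, Fin.predAbove_succ_of_le _ _ ((hi k).2 hk)]
  · refine SSet.stdSimplex.ext _ _ fun k => ?_
    change x₂ k = SSet.stdSimplex.objMk₁.{u} i.succ.castSucc (r k)
    rcases hx₂ k with hk | hk
    · rw [hk]
      refine ((SSet.stdSimplex.objMk₁_apply_eq_zero_iff _ _).2 ?_).symm
      rw [hr₀ k hk]
      have := (hi k).1 hk
      simp only [Fin.lt_def, Fin.le_def, Fin.val_castSucc, Fin.val_succ] at this ⊢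
      omega
    · rw [hk]
      refine ((SSet.stdSimplex.objMk₁_apply_eq_one_iff _ _).2 ?_).symm
      rw [hr₁ k hk]
      have := (hi k).2 hk
      simp only [Fin.le_def, Fin.val_castSucc, Fin.val_succ] at this ⊢
      omega

lemma exists_eq_simplexPt_prismSimplex {n : ℕ}
    (y : SSet.toTop.obj (SSet.stdSimplex.{u}.obj ⦋n⦌ ⊗ SSet.stdSimplex.{u}.obj ⦋1⦌)) :
    ∃ (i : Fin (n + 1)) (a : stdSimplex ℝ (Fin (n + 2))),
      simplexPt _ (prismSimplex i) a = y := by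
  obtain ⟨m, x, a, rfl⟩ := exists_simplexPt y
  obtain ⟨i, ρ, hρ⟩ := exists_eq_map_prismSimplex (m := m.len) x
  exact ⟨i, stdSimplex.map ρ a, by rw [hρ]; exact (simplexPt_map _ ρ _ a).symm⟩

/-- If inserting `S` at place `i + 1` and at place `j + 1` describes the same pair `(T, S)`, then `T
(i + 1), …, T j` all equal `S`. So `a = b`, and the coordinates `a l` with `i < l ≤ j` vanish.
Collapsing those vertices to `i` fixes `a`, and both prism simplices restrict to the same simplex
along the collapse. -/
lemma simplexPt_prismSimplex_eq {n : ℕ} {i j : Fin (n + 1)} (hij : i ≤ j)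
    {a b : stdSimplex ℝ (Fin (n + 2))}
    (h : prismProj.{u} n (simplexPt _ (prismSimplex i) a) =
      prismProj.{u} n (simplexPt _ (prismSimplex j) b)) :
    simplexPt (Δ[n] ⊗ Δ[1] : SSet.{u}) (prismSimplex i) a = simplexPt _ (prismSimplex j) b := by
  have hij' : i.val ≤ j.val := hij
  have h₁ (k : ℕ) := (partialSum_prism_fst.{u} i a k).symm.trans
    ((congrArg (fun t => partialSum t.1 k) h).trans (partialSum_prism_fst.{u} j b k))
  have h₂ := (partialSum_prism_snd.{u} i a).symm.trans
    ((congrArg (fun t => partialSum t.2 1) h).trans (partialSum_prism_snd.{u} j b))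
  have ha := partialSum_mono a
  have hb := partialSum_mono b
  -- Squeeze: `T k ≥ S` for `k > i` because `a` lies in prism `i`, and `T k ≤ S` for `k ≤ j` because
  -- `b` lies in prism `j`.
  have hmid (k : ℕ) (hk : i.val + 1 ≤ k) (hk' : k ≤ j.val + 1) :
      partialSum a k = partialSum a (i + 1) ∧ partialSum b k = partialSum a (i + 1) := by
    have e₁ : partialSum a (i + 1) ≤ partialSum b k := by
      rcases hk'.eq_or_lt with rfl | hk''
      · exact h₂.le
      · have := h₁ k
        rw [if_neg (by omega), if_pos (by omega)] at this
        rw [← this]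
        exact ha (by omega)
    have e₂ : partialSum b k ≤ partialSum a (i + 1) := (hb hk').trans h₂.ge
    have e₃ : partialSum a k ≤ partialSum a (i + 1) := by
      rcases hk.eq_or_lt with rfl | hk''
      · exact le_rfl
      · have := h₁ (k - 1)
        rw [if_neg (by omega), if_pos (by omega), Nat.sub_add_cancel (by omega)] at this
        rw [this]
        exact (hb (by omega)).trans h₂.ge
    exact ⟨le_antisymm e₃ (ha hk), le_antisymm e₂ e₁⟩
  have hab : a = b := partialSum_ext fun k => by
    rcases Nat.lt_or_ge i.val k with hk | hk
    · rcases Nat.lt_or_ge (j.val + 1) k with hk' | hk'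
      · have := h₁ (k - 1)
        rwa [if_neg (by omega), if_neg (by omega), Nat.sub_add_cancel (by omega)] at this
      · rw [(hmid k hk hk').1, (hmid k hk hk').2]
    · have := h₁ k
      rwa [if_pos hk, if_pos (by omega)] at this
  subst hab
  have hsupp (l : Fin (n + 2)) (hl : a l ≠ 0) : ¬ (i.val < l ∧ l ≤ j.val) := fun hl' => by
    have := partialSum_succ a l
    rw [(hmid (l + 1) (by omega) (by omega)).1, (hmid l (by omega) (by omega)).1] at this
    exact hl (by linarith)
  let e : Fin (n + 1 + 1) →o Fin (n + 1 + 1) :=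
    { toFun l := if i.val < l ∧ l ≤ j.val then i.castSucc else l
      monotone' k l hkl := by
        have hkl' : k.val ≤ l.val := hkl
        simp only [Fin.le_def]
        split_ifs <;> (try simp only [Fin.val_castSucc]) <;> omega }
  have he : stdSimplex.map e a = a := by
    refine (stdSimplex_map_congr (g := id) fun l hl => ?_).trans (stdSimplex.map_id_apply a)
    exact if_neg (hsupp l hl)
  have hi := simplexPt_map (Δ[n] ⊗ Δ[1] : SSet.{u}) (SimplexCategory.Hom.mk e) (prismSimplex i) a
  have hj := simplexPt_map (Δ[n] ⊗ Δ[1] : SSet.{u}) (SimplexCategory.Hom.mk e) (prismSimplex j) a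
  have hi' := hi.trans (congrArg (simplexPt _ (prismSimplex i)) he)
  have hj' := hj.trans (congrArg (simplexPt _ (prismSimplex j)) he)
  rw [← hi', ← hj']
  congr 1
  have hel (l : Fin (n + 2)) : (e l).val ≤ i.val ∨ j.val < (e l).val := by
    change (ite _ _ _ : Fin (n + 2)).val ≤ _ ∨ _ < (ite _ _ _ : Fin (n + 2)).val
    split_ifs <;> (try simp only [Fin.val_castSucc]) <;> omega
  refine Prod.ext ?_ ?_
  · refine SSet.stdSimplex.ext _ _ fun l => ?_
    change i.predAbove (e l) = j.predAbove (e l)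
    rcases hel l with hl | hl
    · rw [Fin.predAbove_of_le_castSucc _ _ hl, Fin.predAbove_of_le_castSucc _ _ (hl.trans hij)]
    · rw [Fin.predAbove_of_castSucc_lt _ _ (lt_of_le_of_lt hij' hl : i.val < (e l).val),
        Fin.predAbove_of_castSucc_lt _ _ hl]
  · refine SSet.stdSimplex.ext _ _ fun l => ?_
    change SSet.stdSimplex.objMk₁.{u} i.succ.castSucc (e l) =
      SSet.stdSimplex.objMk₁.{u} j.succ.castSucc (e l)
    rw [SSet.stdSimplex.objMk₁_apply, SSet.stdSimplex.objMk₁_apply]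
    refine if_congr ?_ rfl rfl
    simp only [Fin.lt_def, Fin.val_castSucc, Fin.val_succ]
    have := hel l
    omega

lemma prismProj_injective (n : ℕ) : Function.Injective (prismProj.{u} n) := by
  intro y z h
  obtain ⟨i, a, rfl⟩ := exists_eq_simplexPt_prismSimplex y
  obtain ⟨j, b, rfl⟩ := exists_eq_simplexPt_prismSimplex z
  rcases le_total i j with hij | hij
  · exact simplexPt_prismSimplex_eq hij h
  · exact (simplexPt_prismSimplex_eq hij h.symm).symm

/-- Take the least `i` with `S ≤ T (i + 1)`; it satisfies `i ≤ n` because `T (n + 1) = 1`.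
Minimality gives `T i ≤ S`, so inserting `S` after `T i` keeps the sequence monotone and defines a
point of the `i`-th prism simplex. -/
lemma prismProj_surjective (n : ℕ) : Function.Surjective (prismProj.{u} n) := by
  rintro ⟨t, s⟩
  have hex : ∃ i, partialSum s 1 ≤ partialSum t (i + 1) :=
    ⟨n, (partialSum_mono s (by omega)).trans
      ((partialSum_of_le s le_rfl).trans (partialSum_of_le t le_rfl).symm).le⟩
  obtain ⟨i, hi, hmin⟩ : ∃ i, partialSum s 1 ≤ partialSum t (i + 1) ∧
      ∀ k < i, ¬ partialSum s 1 ≤ partialSum t (k + 1) :=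
    ⟨Nat.find hex, Nat.find_spec hex, fun k hk => Nat.find_min hex hk⟩
  have hin : i ≤ n := by
    by_contra! hn
    refine hmin n hn ?_
    exact (partialSum_mono s (by omega)).trans
      ((partialSum_of_le s le_rfl).trans (partialSum_of_le t le_rfl).symm).le
  have hi' : partialSum t i ≤ partialSum s 1 := by
    rcases Nat.eq_zero_or_pos i with rfl | hpos
    · rw [partialSum_zero, ← partialSum_zero s]
      exact partialSum_mono s (by omega)
    · have := hmin (i - 1) (by omega)
      rw [Nat.sub_add_cancel hpos] at this
      exact (not_le.1 this).le
  let A : ℕ → ℝ := fun k =>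
    if k ≤ i then partialSum t k else if k = i + 1 then partialSum s 1 else partialSum t (k - 1)
  have hA : Monotone A := monotone_nat_of_le_succ fun k => by
    have ht := partialSum_mono t
    simp only [A]
    obtain hk | rfl | rfl | hk : k + 1 ≤ i ∨ k = i ∨ k = i + 1 ∨ i + 2 ≤ k := by omega
    · rw [if_pos (by omega), if_pos hk]
      exact ht (by omega)
    · rw [if_pos le_rfl, if_neg (by omega), if_pos rfl]
      exact hi'
    · rw [if_neg (by omega), if_pos rfl, if_neg (by omega), if_neg (by omega)]
      exact hi
    · rw [if_neg (by omega), if_neg (by omega), if_neg (by omega), if_neg (by omega)]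
      exact ht (by omega)
  obtain ⟨a, ha⟩ := exists_partialSum_eq (N := n + 2) hA
    (by simp only [A]; rw [if_pos (Nat.zero_le _), partialSum_zero])
    (by simp only [A]
        rw [if_neg (by omega), if_neg (by omega), partialSum_of_le t (by omega)])
  refine ⟨simplexPt _ (prismSimplex ⟨i, by omega⟩) a, Prod.ext ?_ ?_⟩
  · refine partialSum_ext fun k => ?_
    rcases Nat.lt_or_ge k (n + 1) with hk | hk
    · rw [partialSum_prism_fst]
      dsimp only
      split_ifs with hki
      · rw [ha _ (by omega)]
        exact if_pos hki
      · rw [ha _ (by omega)]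
        exact (if_neg (by omega)).trans (if_neg (by omega))
    · rw [partialSum_of_le _ hk, partialSum_of_le _ hk]
  · refine partialSum_ext fun k => ?_
    obtain rfl | rfl | hk : k = 0 ∨ k = 1 ∨ 2 ≤ k := by omega
    · rw [partialSum_zero, partialSum_zero]
    · refine (partialSum_prism_snd _ _).trans ((ha (i + 1) (by omega)).trans ?_)
      exact (if_neg (by omega)).trans (if_pos rfl)
    · rw [partialSum_of_le _ hk, partialSum_of_le _ hk]

/-- The `n + 1` prism simplices cover the realization. Compactness upgrades the continuous bijection
`prismProj` to a homeomorphism. -/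
instance (n : ℕ) : CompactSpace (SSet.toTop.obj (Δ[n] ⊗ Δ[1] : SSet.{u})) := by
  let q : (Σ _ : Fin (n + 1), stdSimplex ℝ (Fin (n + 2))) →
      SSet.toTop.obj (Δ[n] ⊗ Δ[1] : SSet.{u}) := fun z => simplexPt _ (prismSimplex z.1) z.2
  have hq : Continuous q := continuous_sigma fun i => continuous_simplexPt (Δ[n] ⊗ Δ[1] : SSet.{u}) (prismSimplex i)
  have hs : Function.Surjective q := fun y => by
    obtain ⟨i, a, h⟩ := exists_eq_simplexPt_prismSimplex y
    exact ⟨⟨i, a⟩, h⟩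
  exact hs.compactSpace hq

/-- The homeomorphism `|Δ[n] × Δ[1]| ≅ Δⁿ × Δ¹`. -/
def prismHomeo (n : ℕ) : SSet.toTop.obj (Δ[n] ⊗ Δ[1] : SSet.{u}) ≃ₜ
    stdSimplex ℝ (Fin (n + 1)) × stdSimplex ℝ (Fin 2) :=
  Continuous.homeoOfEquivCompactToT2
    (f := Equiv.ofBijective _ ⟨prismProj_injective n, prismProj_surjective n⟩)
    (continuous_prismProj n)

lemma prismHomeo_symm_eq {n : ℕ} {y : SSet.toTop.obj (Δ[n] ⊗ Δ[1] : SSet.{u})}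
    {z : stdSimplex ℝ (Fin (n + 1)) × stdSimplex ℝ (Fin 2)} (h : prismProj n y = z) :
    (prismHomeo n).symm z = y :=
  (prismHomeo n).injective (((prismHomeo n).apply_symm_apply z).trans h.symm)

end Prism

/-! ### From simplicial homotopies to weak equivalences -/

section Homotopy

lemma prismHomeo_symm_naturality {n m : ℕ} (θ : ⦋m⦌ ⟶ ⦋n⦌) (a : stdSimplex ℝ (Fin (m + 1)))
    (s : stdSimplex ℝ (Fin 2)) :
    realize (SSet.stdSimplex.{u}.map θ ▷ Δ[1]) ((prismHomeo m).symm (a, s)) =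
      (prismHomeo n).symm (stdSimplex.map θ a, s) := by
  have h : prismProj m ((prismHomeo.{u} m).symm (a, s)) = (a, s) :=
    (prismHomeo m).apply_symm_apply _
  refine (prismHomeo_symm_eq (Prod.ext ?_ ?_)).symm
  · refine (congrArg (SimplexCategory.toTopHomeo ⦋n⦌) (realize_comp _ _ _)).trans ?_
    rw [whiskerRight_fst, ← realize_comp]
    refine (SimplexCategory.toTopHomeo_naturality_apply _ _).trans ?_
    exact congrArg (stdSimplex.map θ) (congrArg Prod.fst h)
  · refine (congrArg (SimplexCategory.toTopHomeo ⦋1⦌) (realize_comp _ _ _)).trans ?_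
    rw [whiskerRight_snd]
    exact congrArg Prod.snd h

lemma stdSimplex_map_const {N N' : ℕ} (i : Fin N') (a : stdSimplex ℝ (Fin N)) :
    stdSimplex.map (fun _ => i) a = stdSimplex.vertex i := by
  ext y
  rw [stdSimplex_map_apply]
  by_cases h : i = y
  · subst h
    rw [Finset.filter_true_of_mem fun _ _ => rfl]
    exact a.2.2.trans (Pi.single_eq_same (M := fun _ => ℝ) i 1).symm
  · rw [Finset.filter_false_of_mem fun _ _ => h, Finset.sum_empty]
    exact (Pi.single_eq_of_ne (M := fun _ => ℝ) (Ne.symm h) 1).symm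

/-- Matches the two ends of the topological prism with the end inclusions of the simplicial one;
this evaluates a realized homotopy at times `0` and `1`. -/
lemma prismHomeo_symm_vertex {n : ℕ} (i : Fin 2) (a : stdSimplex ℝ (Fin (n + 1))) :
    (prismHomeo.{u} n).symm (a, stdSimplex.vertex i) =
      realize (CartesianMonoidalCategory.lift (𝟙 _)
        (SSet.const (SSet.stdSimplex.obj₀Equiv.symm i))) ((SimplexCategory.toTopHomeo ⦋n⦌).symm a) := by
  refine prismHomeo_symm_eq (Prod.ext ?_ ?_)
  · refine (congrArg (SimplexCategory.toTopHomeo ⦋n⦌) (realize_comp _ _ _)).trans ?_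
    rw [lift_fst]
    refine (congrArg (SimplexCategory.toTopHomeo ⦋n⦌) (congrArg (fun t => TopCat.Hom.hom t _)
      (SSet.toTop.map_id _))).trans ?_
    exact Homeomorph.apply_symm_apply _ _
  · refine (congrArg (SimplexCategory.toTopHomeo ⦋1⦌) (realize_comp _ _ _)).trans ?_
    rw [lift_snd]
    have hc : (SSet.const (SSet.stdSimplex.obj₀Equiv.symm i) : Δ[n] ⟶ (Δ[1] : SSet.{u})) =
        SSet.stdSimplex.map (SimplexCategory.const ⦋n⦌ ⦋1⦌ i) := by
      refine SSet.yonedaEquiv.injective ?_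
      rw [SSet.yonedaEquiv_map]
      exact SSet.stdSimplex.ext _ _ fun _ => rfl
    rw [hc]
    refine (SimplexCategory.toTopHomeo_naturality_apply _ _).trans ?_
    exact stdSimplex_map_const _ _

/-- The continuous map `Δⁿ → Map(Δ¹, |K × Δ[1]|)` belonging to an `n`-simplex of `K`. -/
def prismOver (K : SSet.{u}) {m : SimplexCategory} (x : K.obj (op m)) :
    C(stdSimplex ℝ (Fin (m.len + 1)), C(stdSimplex ℝ (Fin 2), SSet.toTop.obj (K ⊗ Δ[1]))) :=
  ContinuousMap.curry (ContinuousMap.comp (realize (SSet.yonedaEquiv.symm x ▷ Δ[1]))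
    ⟨_, (prismHomeo m.len).symm.continuous⟩)

lemma prismOver_apply (K : SSet.{u}) {m : SimplexCategory} (x : K.obj (op m)) (a) (s) :
    prismOver K x a s = realize (SSet.yonedaEquiv.symm x ▷ Δ[1]) ((prismHomeo m.len).symm (a, s)) :=
  rfl

/-- Stands in for the comparison `|K| × Δ¹ → |K × Δ[1]|`. The universal property of `|K|` does not
apply directly to maps out of `|K| × Δ¹`, but it does apply to maps from `|K|` into the space of
paths `Δ¹ → |K × Δ[1]|`. Naturality of the prism homeomorphism makes the family compatible. -/
lemma exists_realization_prism (K : SSet.{u}) :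
    ∃ G : C(SSet.toTop.obj K, C(stdSimplex ℝ (Fin 2), SSet.toTop.obj (K ⊗ Δ[1]))),
      ∀ {m : SimplexCategory} (x : K.obj (op m)) a, G (simplexPt K x a) = prismOver K x a :=
  exists_realization_desc (Z := TopCat.of C(stdSimplex ℝ (Fin 2), SSet.toTop.obj (K ⊗ Δ[1])))
    (prismOver K) fun {m m'} θ x a => by
      refine ContinuousMap.ext fun s => ?_
      change prismOver K _ a s = prismOver K x _ s
      rw [prismOver_apply, prismOver_apply]
      refine Eq.trans ?_ (congrArg _ (prismHomeo_symm_naturality θ a s))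
      refine Eq.trans ?_ (realize_comp _ _ _).symm
      rw [← SSet.yonedaEquiv_symm_naturality_left, comp_whiskerRight]

/-- A simplicial homotopy from the identity of `L` to `g ≫ f`, constant on the image of `f`,
realizes to a homotopy with the same property. -/
lemma exists_realization_homotopy {K L : SSet.{u}} (f : K ⟶ L) (g : L ⟶ K) (H : L ⊗ Δ[1] ⟶ L)
    (h₀ : SSet.ι₀ ≫ H = 𝟙 L) (h₁ : SSet.ι₁ ≫ H = g ≫ f) (hf : f ▷ Δ[1] ≫ H = fst _ _ ≫ f) :
    ∃ G : C(unitInterval × SSet.toTop.obj L, SSet.toTop.obj L),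
      (∀ y, G (0, y) = y) ∧ (∀ y, G (1, y) = realize f (realize g y)) ∧
      ∀ s x, G (s, realize f x) = realize f x := by
  obtain ⟨P, hP⟩ := exists_realization_prism L
  let e := stdSimplexHomeomorphUnitInterval
  have hv (i : Fin 2) (y : SSet.toTop.obj L) : P y (stdSimplex.vertex i) =
      realize (CartesianMonoidalCategory.lift (𝟙 L)
        (SSet.const (SSet.stdSimplex.obj₀Equiv.symm i))) y := by
    obtain ⟨m, x, a, rfl⟩ := exists_simplexPt y
    rw [hP, prismOver_apply, prismHomeo_symm_vertex]
    refine (realize_comp _ _ _).trans (Eq.trans ?_ (realize_comp _ _ _).symm)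
    rfl
  refine ⟨⟨fun z => realize H (P z.2 (e.symm z.1)), ?_⟩, fun y => ?_, fun y => ?_, fun s x => ?_⟩
  · exact (realize H).continuous.comp ((P.continuous.comp continuous_snd).eval
      (e.symm.continuous.comp continuous_fst))
  · have he : e.symm 0 = stdSimplex.vertex 0 := by
      rw [← stdSimplexHomeomorphUnitInterval_zero, Homeomorph.symm_apply_apply]
    refine (congrArg (fun t => realize H (P y t)) he).trans ?_
    rw [hv]
    refine (realize_comp _ _ _).trans ?_
    exact (congrArg (realize · y) h₀).trans (congrArg (fun t => TopCat.Hom.hom t y)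
      (SSet.toTop.map_id _))
  · have he : e.symm 1 = stdSimplex.vertex 1 := by
      rw [← stdSimplexHomeomorphUnitInterval_one, Homeomorph.symm_apply_apply]
    refine (congrArg (fun t => realize H (P y t)) he).trans ?_
    rw [hv]
    refine (realize_comp _ _ _).trans ?_
    exact (congrArg (realize · y) h₁).trans (realize_comp _ _ _).symm
  -- The prism over `f x` is the image under `|f × Δ[1]|` of the prism over `x`. There `H` is the
  -- projection followed by `f`, so the path is constant.
  · obtain ⟨m, x, a, rfl⟩ := exists_simplexPt x
    change realize H (P _ (e.symm s)) = _
    have h := prismHomeo_symm_eq (y := (prismHomeo.{u} m.len).symm (a, e.symm s))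
      ((prismHomeo m.len).apply_symm_apply _)
    have ha := congrArg Prod.fst ((prismHomeo.{u} m.len).apply_symm_apply (a, e.symm s))
    have ha' : realize (fst _ _) ((prismHomeo.{u} m.len).symm (a, e.symm s)) =
        (SimplexCategory.toTopHomeo m).symm a :=
      ((SimplexCategory.toTopHomeo m).symm_apply_eq.2 ha.symm).symm
    rw [realize_simplexPt, hP, prismOver_apply, ← SSet.yonedaEquiv_symm_comp, comp_whiskerRight,
      ← realize_comp]
    refine (realize_comp _ _ _).trans ?_
    rw [hf, ← realize_comp]
    refine (congrArg (realize f) (realize_comp _ _ _)).trans ?_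
    rw [whiskerRight_fst, ← realize_comp, ha', realize_comp, ← realize_simplexPt]
    exact (realize_comp _ _ _).symm

/-- The data of a topological homotopy exhibiting `|f|` as a deformation retract. -/
def RealizedRetract {K L : SSet.{u}} (f : K ⟶ L) (g : L ⟶ K) : Prop :=
  f ≫ g = 𝟙 K ∧ ∃ G : C(unitInterval × SSet.toTop.obj L, SSet.toTop.obj L),
      (∀ y, G (0, y) = y) ∧ (∀ y, G (1, y) = realize f (realize g y)) ∧
      ∀ s x, G (s, realize f x) = realize f x

variable {K L : SSet.{u}} {f : K ⟶ L} {g : L ⟶ K}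

lemma RealizedRetract.realize_realize (h : RealizedRetract f g) (x : SSet.toTop.obj K) :
    realize g (realize f x) = x :=
  (realize_comp _ _ _).trans ((congrArg (realize · x) h.1).trans
    (congrArg (fun t => TopCat.Hom.hom t x) (SSet.toTop.map_id _)))

lemma RealizedRetract.piMap_left (h : RealizedRetract f g) (n : ℕ) {x : SSet.toTop.obj K}
    {y : SSet.toTop.obj L} (hx : realize f x = y) (hy : realize g y = x)
    (z : π_ n (SSet.toTop.obj K) x) : piMap (realize g) n hy (piMap (realize f) n hx z) = z := by
  induction z using Quotient.inductionOn with | _ α => ?_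
  exact congrArg (Quotient.mk _) (Subtype.ext (ContinuousMap.ext fun t => h.realize_realize _))

/-- The homotopy `G` fixes the base point because it lies in the image of `f`. Thus `(s, t) ↦ G (s,
α t)` is a homotopy relative to the boundary of the cube, and no change of base point is needed. -/
lemma RealizedRetract.piMap_right (h : RealizedRetract f g) (n : ℕ) {x : SSet.toTop.obj K}
    {y : SSet.toTop.obj L} (hx : realize f x = y) (hy : realize g y = x)
    (z : π_ n (SSet.toTop.obj L) y) : piMap (realize f) n hx (piMap (realize g) n hy z) = z := by
  induction z using Quotient.inductionOn with | _ α => ?_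
  obtain ⟨-, G, h₀, h₁, hG⟩ := h
  refine (Quotient.sound ?_).symm
  refine ⟨⟨⟨G.comp (ContinuousMap.prodMap (ContinuousMap.id _) α.1), fun t => ?_, fun t => ?_⟩,
    fun s t ht => ?_⟩⟩
  · exact h₀ _
  · exact h₁ _
  · have ht' : α.1 t = realize f x := (α.2 t ht).trans hx.symm
    change G (s, α.1 t) = α.1 t
    rw [ht', hG]

lemma RealizedRetract.sSetWeq (h : RealizedRetract f g) : SSetWeq f := by
  refine ⟨⟨?_, ?_⟩, fun n x => ⟨?_, ?_⟩⟩
  · refine Function.LeftInverse.injective (g := pi0Map (realize g)) fun z => ?_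
    induction z using Quotient.inductionOn with | _ x => ?_
    exact congrArg ZerothHomotopy.mk (h.realize_realize x)
  · intro z
    induction z using Quotient.inductionOn with | _ y => ?_
    refine ⟨ZerothHomotopy.mk (realize g y), ?_⟩
    obtain ⟨-, G, h₀, h₁, hG⟩ := h
    refine Eq.symm (Quotient.sound ⟨⟨⟨fun s => G (s, y), by fun_prop⟩, h₀ y, h₁ y⟩⟩)
  · exact Function.LeftInverse.injective fun z => h.piMap_left _ rfl (h.realize_realize x) z
  · exact Function.RightInverse.surjective fun z => h.piMap_right _ rfl (h.realize_realize x) z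

/-- Since `g` is a map of spectra it induces a map on stable homotopy, and both composites can be
checked on representatives at a fixed level. The levelwise homotopies therefore need no
compatibility with the structure maps. -/
lemma Spectrum.weq_of_realizedRetract {E F : Spectrum.{u}} (f : E ⟶ F) (g : F ⟶ E)
    (h : ∀ n, RealizedRetract (forgetP.map (f.app n)) (forgetP.map (g.app n))) :
    Spectrum.Weq f := by
  refine fun k => ⟨Function.LeftInverse.injective (g := Spectrum.stableMap g k) fun z => ?_,
    Function.RightInverse.surjective (g := Spectrum.stableMap g k) fun z => ?_⟩
  · obtain ⟨p, z⟩ := z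
    exact congrArg (fun t => Quot.mk _ (⟨p, t⟩ : Spectrum.PreStable E k))
      ((h p.1.1).piMap_left _ (realize_basePt _) (realize_basePt _) z)
  · obtain ⟨p, z⟩ := z
    exact congrArg (fun t => Quot.mk _ (⟨p, t⟩ : Spectrum.PreStable F k))
      ((h p.1.1).piMap_right _ (realize_basePt _) (realize_basePt _) z)

end Homotopy

end

end SemiTop

namespace SemiTop

open AlgebraicGeometry

noncomputable section

/-! ### Morphisms to `𝔸¹` as regular functions, and the cylinders `U × 𝔸¹` -/

section AffineLine

/-- The regular function belonging to a morphism to the affine line. -/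
def funOf {Z : SchC} (φ : Z ⟶ A1) : Γ(Z.left, ⊤) :=
  Scheme.Hom.appTop (X := Z.left) (Y := 𝔸(Fin 1; specC)) φ.left (AffineSpace.coord specC 0)

/-- The morphism to the affine line belonging to a regular function. -/
def toA1 {Z : SchC} (a : Γ(Z.left, ⊤)) : Z ⟶ A1 :=
  MorphismProperty.Over.homMk (AffineSpace.homOfVector Z.hom fun _ => a)
    (AffineSpace.homOfVector_over _ _)

lemma funOf_toA1 {Z : SchC} (a : Γ(Z.left, ⊤)) : funOf (toA1 a) = a :=
  AffineSpace.homOfVector_appTop_coord (S := specC) (n := Fin 1) Z.hom (fun _ => a) 0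

lemma funOf_comp {Z Z' : SchC} (φ : Z ⟶ Z') (ψ : Z' ⟶ A1) :
    funOf (φ ≫ ψ) = φ.left.appTop (funOf ψ) := rfl

lemma a1_hom_ext {Z : SchC} {φ ψ : Z ⟶ A1} (h : funOf φ = funOf ψ) : φ = ψ := by
  ext : 1
  refine AffineSpace.hom_ext (S := specC) (n := Fin 1) ?_ fun i => ?_
  · exact (MorphismProperty.Over.w φ).trans (MorphismProperty.Over.w ψ).symm
  · obtain rfl := Subsingleton.elim i 0
    exact h

/-- The regular function with constant value `c`. -/
def constFun (Z : SchC) (c : ℂ) : Γ(Z.left, ⊤) :=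
  Z.hom.appTop ((Scheme.ΓSpecIso (CommRingCat.of ℂ)).inv c)

lemma constFun_comp {Z Z' : SchC} (φ : Z ⟶ Z') (c : ℂ) :
    φ.left.appTop (constFun Z' c) = constFun Z c := by
  unfold constFun
  rw [← MorphismProperty.Over.w φ, Scheme.Hom.comp_appTop]
  rfl

lemma constFun_zero (Z : SchC) : constFun Z 0 = 0 := by
  unfold constFun; rw [map_zero, map_zero]

lemma constFun_one (Z : SchC) : constFun Z 1 = 1 := by
  unfold constFun; rw [map_one, map_one]

/-- The product of two morphisms to the affine line. -/
def mulA1 {Z : SchC} (φ ψ : Z ⟶ A1) : Z ⟶ A1 := toA1 (funOf φ * funOf ψ)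

lemma comp_mulA1 {Z Z' : SchC} (χ : Z ⟶ Z') (φ ψ : Z' ⟶ A1) :
    χ ≫ mulA1 φ ψ = mulA1 (χ ≫ φ) (χ ≫ ψ) := by
  refine a1_hom_ext ?_
  rw [funOf_comp, mulA1, mulA1, funOf_toA1, funOf_toA1, funOf_comp, funOf_comp, map_mul]

/-- The constant morphism to the affine line. -/
def constA1 (Z : SchC) (c : ℂ) : Z ⟶ A1 := toA1 (constFun Z c)

lemma comp_constA1 {Z Z' : SchC} (φ : Z ⟶ Z') (c : ℂ) : φ ≫ constA1 Z' c = constA1 Z c := by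
  refine a1_hom_ext ?_
  rw [funOf_comp, constA1, constA1, funOf_toA1, funOf_toA1, constFun_comp]

lemma mulA1_one {Z : SchC} (φ : Z ⟶ A1) : mulA1 (constA1 Z 1) φ = φ := by
  refine a1_hom_ext ?_
  rw [mulA1, constA1, funOf_toA1, funOf_toA1, constFun_one, one_mul]

lemma mulA1_zero {Z : SchC} (φ : Z ⟶ A1) : mulA1 (constA1 Z 0) φ = constA1 Z 0 := by
  refine a1_hom_ext ?_
  rw [mulA1, constA1, funOf_toA1, funOf_toA1, constFun_zero, zero_mul]

/-- The product `U × 𝔸¹` of a reduced scheme with the affine line. -/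
def cyl (U : VarC) : VarC where
  obj := MorphismProperty.Over.mk ⊤ (𝔸(Fin 1; U.obj.left) ↘ U.obj.left ≫ U.obj.hom)
    (finTypeSep.comp_mem _ _ ⟨inferInstance, inferInstance, inferInstance⟩ U.obj.prop)
  property := by
    have : IsReduced U.obj.left := U.property
    exact inferInstanceAs (IsReduced 𝔸(Fin 1; U.obj.left))

/-- The projection `U × 𝔸¹ ⟶ U`. -/
def cylProj (U : VarC) : cyl U ⟶ U :=
  ObjectProperty.homMk (MorphismProperty.Over.homMk (𝔸(Fin 1; U.obj.left) ↘ U.obj.left) rfl)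

/-- The coordinate function of `U × 𝔸¹`. -/
def cylFun (U : VarC) : Γ((cyl U).obj.left, ⊤) := AffineSpace.coord U.obj.left 0

/-- The morphism to `U × 𝔸¹` belonging to a morphism to `U` and a regular function. -/
def cylLift {Z U : VarC} (h : Z ⟶ U) (a : Γ(Z.obj.left, ⊤)) : Z ⟶ cyl U :=
  ObjectProperty.homMk (MorphismProperty.Over.homMk (AffineSpace.homOfVector h.hom.left fun _ => a)
    (by
      refine (Category.assoc _ _ _).symm.trans ?_
      refine (congrArg (· ≫ U.obj.hom) (AffineSpace.homOfVector_over _ _)).trans ?_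
      exact MorphismProperty.Over.w h.hom))

lemma cylLift_proj {Z U : VarC} (h : Z ⟶ U) (a : Γ(Z.obj.left, ⊤)) :
    cylLift h a ≫ cylProj U = h := by
  refine ObjectProperty.hom_ext _ ?_
  ext : 1
  exact AffineSpace.homOfVector_over _ _

lemma cylLift_fun {Z U : VarC} (h : Z ⟶ U) (a : Γ(Z.obj.left, ⊤)) :
    (cylLift h a).hom.left.appTop (cylFun U) = a :=
  AffineSpace.homOfVector_appTop_coord (n := Fin 1) h.hom.left (fun _ => a) 0

/-- The map on `U × 𝔸¹` induced by a morphism of `U`. -/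
def cylMap {U V : VarC} (h : U ⟶ V) : cyl U ⟶ cyl V := cylLift (cylProj U ≫ h) (cylFun U)

end AffineLine

/-! ### Regular functions and the analytic topology -/

section Continuity

variable {X : SchC}

/-- Evaluation of regular functions at a complex point as a ring homomorphism. -/
def evalHom (p : Points X) (V : X.left.Opens) (h : ⊤ ≤ p.hom ⁻¹ᵁ V) : Γ(X.left, V) →+* ℂ :=
  (Scheme.ΓSpecIso (CommRingCat.of ℂ)).hom.hom.comp (p.hom.appLE V ⊤ h).hom

lemma evalHom_apply (p : Points X) (V : X.left.Opens) (h : ⊤ ≤ p.hom ⁻¹ᵁ V) (f : Γ(X.left, V)) :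
    evalHom p V h f = evalAt p V h f := rfl

lemma evalHom_res (p : Points X) {V V' : X.left.Opens} (i : V' ≤ V) (h : ⊤ ≤ p.hom ⁻¹ᵁ V)
    (h' : ⊤ ≤ p.hom ⁻¹ᵁ V') (f : Γ(X.left, V)) :
    evalHom p V' h' (X.left.presheaf.map (homOfLE i).op f) = evalHom p V h f := by
  have := Scheme.Hom.map_appLE p.hom h' (homOfLE i).op
  exact congrArg (fun t => (Scheme.ΓSpecIso (CommRingCat.of ℂ)).hom (t.hom f)) this

/-- A function is invertible on its basic open, so its value there is nonzero. Conversely, a nonzero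
complex number is a unit on `Spec ℂ`, and the basic open of a unit is everything. -/
lemma le_preimage_basicOpen_iff (p : Points X) {V : X.left.Opens} (h : ⊤ ≤ p.hom ⁻¹ᵁ V)
    (f : Γ(X.left, V)) : ⊤ ≤ p.hom ⁻¹ᵁ (X.left.basicOpen f) ↔ evalHom p V h f ≠ 0 := by
  constructor
  · intro h'
    rw [← evalHom_res p (X.left.basicOpen_le f) h h']
    exact ((RingedSpace.isUnit_res_basicOpen _ f).map (evalHom p _ h')).ne_zero
  · intro h'
    have hu : IsUnit (p.hom.appLE V ⊤ h f) := by
      have := (IsUnit.mk0 _ h').map (Scheme.ΓSpecIso (CommRingCat.of ℂ)).inv.hom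
      convert this using 1
      exact (congrArg (fun t => t.hom (p.hom.appLE V ⊤ h f))
        (Scheme.ΓSpecIso (CommRingCat.of ℂ)).hom_inv_id).symm
    have h₁ := Scheme.basicOpen_of_isUnit _ hu
    rw [Scheme.basicOpen_appLE] at h₁
    rw [← h₁]
    exact inf_le_right

lemma isOpen_setOf_le_preimage (V : X.left.Opens) : IsOpen {p : Points X | ⊤ ≤ p.hom ⁻¹ᵁ V} := by
  refine TopologicalSpace.isOpen_generateFrom_of_mem ⟨V, 0, Set.univ, isOpen_univ, ?_⟩
  ext p
  simp [basicSet]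

lemma continuous_evalHom {T : Type*} [TopologicalSpace T] {f : T → Points X} (hf : Continuous f)
    (V : X.left.Opens) (h : ∀ t, ⊤ ≤ (f t).hom ⁻¹ᵁ V) (a : Γ(X.left, V)) :
    Continuous fun t => evalHom (f t) V (h t) a := by
  refine continuous_def.2 fun W hW => ?_
  have : IsOpen (basicSet V a W) :=
    TopologicalSpace.isOpen_generateFrom_of_mem ⟨V, a, W, hW, rfl⟩
  convert this.preimage hf using 1
  ext t
  exact ⟨fun h' => ⟨h t, h'⟩, fun ⟨_, h'⟩ => h'⟩

/-- A map into an affine open is continuous if all regular functions are continuous along it. -/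
lemma continuous_of_isAffineOpen {T : Type*} [TopologicalSpace T] {f : T → Points X}
    {D : X.left.Opens} (hD : IsAffineOpen D) (h : ∀ t, ⊤ ≤ (f t).hom ⁻¹ᵁ D)
    (hc : ∀ a : Γ(X.left, D), Continuous fun t => evalHom (f t) D (h t) a) : Continuous f := by
  refine continuous_generateFrom_iff.2 ?_
  rintro _ ⟨V, φ, W, hW, rfl⟩
  refine isOpen_iff_mem_nhds.2 fun t₀ ht₀ => ?_
  obtain ⟨hV, hφ⟩ : ∃ hV : ⊤ ≤ (f t₀).hom ⁻¹ᵁ V, evalHom (f t₀) V hV φ ∈ W := ht₀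
  let z : specC := IsLocalRing.closedPoint ℂ
  have hzV : (f t₀).hom z ∈ V := hV (Set.mem_univ z)
  -- Shrink `V` around `f t₀` to a basic open of `D`. On it `φ = g / r ^ n` with `g`, `r` regular on
  -- `D`, so its values are quotients of functions continuous in `t`.
  obtain ⟨r, hr, hzr⟩ := hD.exists_basicOpen_le ⟨_, hzV⟩ (h t₀ (Set.mem_univ z))
  have hr₀ : ⊤ ≤ (f t₀).hom ⁻¹ᵁ X.left.basicOpen r := by
    intro y _
    obtain rfl : y = z := Subsingleton.elim (α := PrimeSpectrum ℂ) _ _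
    exact hzr
  have := hD.isLocalization_basicOpen r
  obtain ⟨n, g, hg⟩ := IsLocalization.Away.surj r (X.left.presheaf.map (homOfLE hr).op φ)
  have key (t : T) (ht : ⊤ ≤ (f t).hom ⁻¹ᵁ X.left.basicOpen r) (htV : ⊤ ≤ (f t).hom ⁻¹ᵁ V) :
      evalHom (f t) V htV φ = evalHom (f t) D (h t) g / evalHom (f t) D (h t) r ^ n := by
    have h₁ := congrArg (evalHom (f t) _ ht) hg
    rw [map_mul, map_pow, evalHom_res _ _ htV] at h₁
    have h₂ (a : Γ(X.left, D)) : evalHom (f t) _ ht (algebraMap _ _ a) = evalHom (f t) D (h t) a :=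
      evalHom_res _ (X.left.basicOpen_le r) (h t) ht a
    rw [h₂, h₂] at h₁
    exact (eq_div_iff (pow_ne_zero _ ((le_preimage_basicOpen_iff _ _ _).1 ht))).2 h₁
  have hcont : ContinuousAt
      (fun t => evalHom (f t) D (h t) g / evalHom (f t) D (h t) r ^ n) t₀ :=
    (hc g).continuousAt.div ((hc r).continuousAt.pow n)
      (pow_ne_zero _ ((le_preimage_basicOpen_iff _ _ _).1 hr₀))
  have hev := hcont.eventually_mem (hW.mem_nhds (key t₀ hr₀ hV ▸ hφ))
  have hne := (hc r).continuousAt.eventually_ne ((le_preimage_basicOpen_iff _ (h t₀) r).1 hr₀)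
  filter_upwards [hev, hne] with t h₁ h₂
  have ht := (le_preimage_basicOpen_iff _ (h t) r).2 h₂
  have htV : ⊤ ≤ (f t).hom ⁻¹ᵁ V := ht.trans ((f t).hom.preimage_mono hr)
  exact ⟨htV, (evalHom_apply _ _ _ _).symm.trans (key t ht htV) ▸ h₁⟩

end Continuity

/-! ### Continuity of `t ↦ (f t, α t)` into `(U × 𝔸¹)^an` -/

section Cylinder

/-- The regular function on `Spec ℂ` with value `c`. -/
def scalarFun (c : ℂ) : Γ(specC, ⊤) := (Scheme.ΓSpecIso (CommRingCat.of ℂ)).inv c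

lemma hom_scalarFun (c : ℂ) : (Scheme.ΓSpecIso (CommRingCat.of ℂ)).hom (scalarFun c) = c :=
  congrArg (fun t => t.hom c) (Scheme.ΓSpecIso (CommRingCat.of ℂ)).inv_hom_id

lemma scalarFun_hom (a : Γ(specC, ⊤)) :
    scalarFun ((Scheme.ΓSpecIso (CommRingCat.of ℂ)).hom a) = a :=
  congrArg (fun t => t.hom a) (Scheme.ΓSpecIso (CommRingCat.of ℂ)).hom_inv_id

/-- The complex point `(p, c)` of `U × 𝔸¹`. -/
def pairPt {U : VarC} (p : Points U.obj) (c : ℂ) : Points (cyl U).obj where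
  hom := AffineSpace.homOfVector p.hom fun _ => scalarFun c
  w := by
    refine (Category.assoc _ _ _).symm.trans ?_
    refine (congrArg (· ≫ U.obj.hom) (AffineSpace.homOfVector_over _ _)).trans ?_
    exact p.w

lemma evalHom_top {X : SchC} (p : Points X) (a : Γ(X.left, ⊤)) :
    evalHom p ⊤ le_rfl a = (Scheme.ΓSpecIso (CommRingCat.of ℂ)).hom (p.hom.appTop a) := by
  have : p.hom.appLE ⊤ ⊤ le_rfl = p.hom.appTop := p.hom.appLE_eq_app
  exact congrArg (fun t => (Scheme.ΓSpecIso (CommRingCat.of ℂ)).hom (t.hom a)) this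

lemma pointsMap_cylLift {Z U : VarC} (h : Z ⟶ U) (a : Γ(Z.obj.left, ⊤)) (p : Points Z.obj) :
    pointsMap (cylLift h a).hom p = pairPt (pointsMap h.hom p) (evalHom p ⊤ le_rfl a) := by
  refine Points.ext ?_
  refine (AffineSpace.comp_homOfVector _ _ _).trans ?_
  refine congrArg (AffineSpace.homOfVector (p.hom ≫ h.hom.left)) (funext fun _ => ?_)
  rw [evalHom_top, scalarFun_hom]
  rfl

lemma pointsMap_cylProj {U : VarC} (p : Points U.obj) (c : ℂ) :
    pointsMap (cylProj U).hom (pairPt p c) = p :=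
  Points.ext (AffineSpace.homOfVector_over _ _)

lemma evalHom_cylFun {U : VarC} (p : Points U.obj) (c : ℂ) :
    evalHom (pairPt p c) ⊤ le_rfl (cylFun U) = c := by
  rw [evalHom_top]
  refine Eq.trans ?_ (hom_scalarFun c)
  exact congrArg _ (AffineSpace.homOfVector_appTop_coord (n := Fin 1) p.hom
    (fun _ => scalarFun c) 0)

lemma evalHom_constFun {X : SchC} (p : Points X) (c : ℂ) :
    evalHom p ⊤ le_rfl (constFun X c) = c := by
  rw [evalHom_top]
  refine Eq.trans ?_ (hom_scalarFun c)
  refine congrArg _ ?_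
  change p.hom.appTop (X.hom.appTop (scalarFun c)) = scalarFun c
  have h : (p.hom ≫ X.hom).appTop = 𝟙 _ := by rw [p.w]; rfl
  exact congrArg (fun t => t.hom (scalarFun c)) h

lemma appLE_comp_apply {X Y Z : Scheme.{0}} {r : X ⟶ Z} (q : X ⟶ Y) (ψ : Y ⟶ Z) (e : r = q ≫ ψ)
    {D : Z.Opens} (h : ⊤ ≤ r ⁻¹ᵁ D) (h' : ⊤ ≤ ψ ⁻¹ᵁ D) (a : Γ(Z, D)) :
    r.appLE D ⊤ h a = q.appTop (ψ.appLE D ⊤ h' a) := by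
  subst e
  have h₁ := Scheme.Hom.appLE_comp_appLE q ψ D ⊤ ⊤ h' le_rfl
  have h₂ : q.appLE ⊤ ⊤ le_rfl = q.appTop := q.appLE_eq_app
  rw [h₂] at h₁
  exact (congrArg (fun t => t.hom a) h₁).symm

lemma topIso_hom_ι_appLE {X : Scheme.{0}} (D : X.Opens) (h : ⊤ ≤ D.ι ⁻¹ᵁ D) :
    D.topIso.hom ≫ D.ι.appLE D ⊤ h = 𝟙 _ := by
  rw [Scheme.Opens.ι_appLE, ← D.topIso.hom_inv_id]
  rfl

variable {T : Type*} [TopologicalSpace T]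

/-- The points `(f t, α t)` of `U × 𝔸¹` vary continuously if `f t` stays in an affine open. -/
lemma continuous_pairPt_of_isAffineOpen {U : VarC} {f : T → Points U.obj} (hf : Continuous f)
    {α : T → ℂ} (hα : Continuous α) {D : U.obj.left.Opens} (hD : IsAffineOpen D)
    (h : ∀ t, ⊤ ≤ (f t).hom ⁻¹ᵁ D) : Continuous fun t => pairPt (f t) (α t) := by
  let π : 𝔸(Fin 1; U.obj.left) ⟶ U.obj.left := 𝔸(Fin 1; U.obj.left) ↘ U.obj.left
  have hπ (t : T) : (pairPt (f t) (α t)).hom ≫ π = (f t).hom :=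
    AffineSpace.homOfVector_over (S := U.obj.left) _ _
  have hD' : IsAffineOpen (X := (cyl U).obj.left) (π ⁻¹ᵁ D) := hD.preimage π
  have h' (t : T) : ⊤ ≤ (pairPt (f t) (α t)).hom ⁻¹ᵁ (π ⁻¹ᵁ D) := by
    have : ⊤ ≤ ((pairPt (f t) (α t)).hom ≫ π) ⁻¹ᵁ D := by rw [hπ]; exact h t
    exact this
  refine continuous_of_isAffineOpen hD' h' fun a => ?_
  have : IsAffine D := hD
  -- The points factor through `D × 𝔸¹` with `D` affine, where every regular function is a
  -- polynomial in the coordinate with coefficients regular on `D`.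
  let ψ : 𝔸(Fin 1; D) ⟶ 𝔸(Fin 1; U.obj.left) := AffineSpace.map (Fin 1) D.ι
  have hψ : ⊤ ≤ ψ ⁻¹ᵁ (π ⁻¹ᵁ D) := by
    have : ⊤ ≤ (ψ ≫ π) ⁻¹ᵁ D := by
      rw [AffineSpace.map_over]
      intro x _
      exact ((𝔸(Fin 1; D) ↘ D.toScheme) x).2
    exact this
  let l (t : T) : specC ⟶ D := IsOpenImmersion.lift D.ι (f t).hom (by
    rintro _ ⟨y, rfl⟩
    rw [Scheme.Opens.range_ι]
    exact h t (Set.mem_univ y))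
  have hl (t : T) : l t ≫ D.ι = (f t).hom := IsOpenImmersion.lift_fac _ _ _
  let q (t : T) : specC ⟶ 𝔸(Fin 1; D) := AffineSpace.homOfVector (l t) fun _ => scalarFun (α t)
  have hq (t : T) : (pairPt (f t) (α t)).hom = q t ≫ ψ := by
    refine Eq.symm ?_
    refine (AffineSpace.comp_homOfVector _ _ _).trans ?_
    have e₁ : q t ≫ 𝔸(Fin 1; D) ↘ D.toScheme ≫ D.ι = (f t).hom := by
      rw [← Category.assoc, AffineSpace.homOfVector_over, hl]
    have e₂ : (q t).appTop ∘ AffineSpace.coord D.toScheme = fun _ => scalarFun (α t) :=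
      funext fun i => AffineSpace.homOfVector_appTop_coord _ _ _
    exact congrArg₂ AffineSpace.homOfVector e₁ e₂
  obtain ⟨P, hP⟩ : ∃ P : MvPolynomial (Fin 1) Γ(D, ⊤),
      MvPolynomial.eval₂Hom ((𝔸(Fin 1; D) ↘ D.toScheme).appTop).hom
        (AffineSpace.coord D.toScheme) P = ψ.appLE (π ⁻¹ᵁ D) ⊤ hψ a := by
    have h₁ := AffineSpace.isoOfIsAffine_hom_appTop (n := Fin 1) D.toScheme
    have h₂ : IsIso (AffineSpace.isoOfIsAffine (Fin 1) D.toScheme).hom.appTop :=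
      inferInstanceAs (IsIso ((AffineSpace.isoOfIsAffine (Fin 1) D.toScheme).hom.app ⊤))
    rw [h₁] at h₂
    have h₃ := IsIso.of_isIso_comp_left (Scheme.ΓSpecIso _).hom
      (CommRingCat.ofHom (MvPolynomial.eval₂Hom ((𝔸(Fin 1; D) ↘ D.toScheme).appTop).hom
        (AffineSpace.coord D.toScheme)))
    exact ((ConcreteCategory.isIso_iff_bijective _).1 h₃).2 _
  have hval (t : T) : evalHom (pairPt (f t) (α t)) (π ⁻¹ᵁ D) (h' t) a =
      (Scheme.ΓSpecIso (CommRingCat.of ℂ)).hom ((q t).appTop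
        (MvPolynomial.eval₂Hom ((𝔸(Fin 1; D) ↘ D.toScheme).appTop).hom
          (AffineSpace.coord D.toScheme) P)) := by
    rw [hP]
    exact congrArg _ (appLE_comp_apply _ _ (hq t) (h' t) hψ a)
  simp_rw [hval]
  clear hP hval
  -- Coefficients vary continuously because `f` does, the coordinate takes the value `α t`, and sums
  -- and products preserve continuity.
  induction P using MvPolynomial.induction_on with
  | C c =>
    have hc := continuous_evalHom hf D h (D.topIso.hom c)
    convert hc using 2 with t
    rw [MvPolynomial.coe_eval₂Hom, MvPolynomial.eval₂_C]
    have e₁ : (q t ≫ 𝔸(Fin 1; D) ↘ D.toScheme) = l t := AffineSpace.homOfVector_over _ _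
    have e₂ : (q t).appTop ((𝔸(Fin 1; D) ↘ D.toScheme).appTop c) = (l t).appTop c :=
      congrArg (fun s : specC ⟶ D.toScheme => s.appTop c) e₁
    refine congrArg (Scheme.ΓSpecIso (CommRingCat.of ℂ)).hom (e₂.trans ?_)
    refine Eq.trans ?_ (appLE_comp_apply (l t) D.ι (hl t).symm (h t)
      D.ι_preimage_self.ge _).symm
    exact congrArg (l t).appTop (congrArg (fun s => s.hom c) (topIso_hom_ι_appLE D _)).symm
  | add P Q hP hQ =>
    simp only [map_add]
    exact hP.add hQ
  | mul_X P i hP =>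
    simp only [map_mul]
    refine hP.mul ?_
    convert hα using 2 with t
    rw [MvPolynomial.coe_eval₂Hom, MvPolynomial.eval₂_X]
    exact (congrArg _ (AffineSpace.homOfVector_appTop_coord _ _ _)).trans (hom_scalarFun _)

/-- Continuity is local on `T`, and the parameters `t` whose point `f t` lies in a given affine open
form an open set, so the affine case applies. -/
lemma continuous_pairPt {U : VarC} {f : T → Points U.obj} (hf : Continuous f)
    {α : T → ℂ} (hα : Continuous α) : Continuous fun t => pairPt (f t) (α t) := by
  refine continuous_iff_continuousAt.2 fun t₀ => ?_
  let z : specC := IsLocalRing.closedPoint ℂ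
  obtain ⟨_, ⟨D, hD, rfl⟩, hz, -⟩ := U.obj.left.isBasis_affineOpens.exists_subset_of_mem_open
    (Set.mem_univ ((f t₀).hom z)) isOpen_univ
  have hN : IsOpen {t | ⊤ ≤ (f t).hom ⁻¹ᵁ D} := (isOpen_setOf_le_preimage D).preimage hf
  have ht₀ : ⊤ ≤ (f t₀).hom ⁻¹ᵁ D := by
    intro y _
    obtain rfl : y = z := Subsingleton.elim (α := PrimeSpectrum ℂ) _ _
    exact hz
  have := continuous_pairPt_of_isAffineOpen (T := {t | ⊤ ≤ (f t).hom ⁻¹ᵁ D})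
    (hf.comp continuous_subtype_val) (hα.comp continuous_subtype_val) hD fun t => t.2
  exact (continuousOn_iff_continuous_domRestrict.2 this).continuousAt (hN.mem_nhds ht₀)

end Cylinder

/-! ### The scaling action of continuous functions on `E(T × 𝔸¹ × X)` -/

section Scaling

universe v w

/-- The continuous map `T → (U × 𝔸¹)^an` with components `f` and `α`. -/
def pairMap {T : TopCat.{0}} {U : VarC} (f : T ⟶ an.obj U) (α : C(T, ℂ)) : T ⟶ an.obj (cyl U) :=
  TopCat.ofHom ⟨fun t => pairPt (f.hom t) (α t), continuous_pairPt f.hom.continuous α.continuous⟩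

lemma pairMap_proj {T : TopCat.{0}} {U : VarC} (f : T ⟶ an.obj U) (α : C(T, ℂ)) :
    pairMap f α ≫ an.map (cylProj U) = f :=
  TopCat.hom_ext (ContinuousMap.ext fun _ => pointsMap_cylProj _ _)

lemma comp_pairMap {T T' : TopCat.{0}} {U : VarC} (β : T ⟶ T') (f : T' ⟶ an.obj U) (α : C(T', ℂ)) :
    β ≫ pairMap f α = pairMap (β ≫ f) (α.comp β.hom) := rfl

lemma pairMap_cylMap {T : TopCat.{0}} {U V : VarC} (f : T ⟶ an.obj U) (α : C(T, ℂ)) (h : U ⟶ V) :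
    pairMap f α ≫ an.map (cylMap h) = pairMap (f ≫ an.map h) α := by
  refine TopCat.hom_ext (ContinuousMap.ext fun t => ?_)
  refine (pointsMap_cylLift _ _ _).trans ?_
  refine congrArg₂ pairPt ?_ (evalHom_cylFun _ _)
  exact congrArg (pointsMap h.hom) (pointsMap_cylProj _ _)

/-- The section of `U × 𝔸¹` with constant value `c`. -/
def cylSection (U : VarC) (c : ℂ) : U ⟶ cyl U := cylLift (𝟙 U) (constFun U.obj c)

lemma comp_cylSection {T : TopCat.{0}} {U : VarC} (f : T ⟶ an.obj U) (c : ℂ) :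
    f ≫ an.map (cylSection U c) = pairMap f (ContinuousMap.const _ c) := by
  refine TopCat.hom_ext (ContinuousMap.ext fun t => ?_)
  refine (pointsMap_cylLift _ _ _).trans ?_
  refine congrArg₂ pairPt ?_ (evalHom_constFun _ _)
  exact Points.ext (Category.comp_id _)

/-- Scaling of the coordinate of `𝔸¹ × X` by a morphism to the affine line. -/
def scale {Z X : SchC} (a : Z ⟶ A1) (b : Z ⟶ A1 ⨯ X) : Z ⟶ A1 ⨯ X :=
  prod.lift (mulA1 a (b ≫ prod.fst)) (b ≫ prod.snd)

lemma comp_scale {Z Z' X : SchC} (h : Z' ⟶ Z) (a : Z ⟶ A1) (b : Z ⟶ A1 ⨯ X) :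
    h ≫ scale a b = scale (h ≫ a) (h ≫ b) := by
  simp [scale, prod.comp_lift, comp_mulA1]

lemma scale_snd {Z X : SchC} (a : Z ⟶ A1) (b : Z ⟶ A1 ⨯ X) :
    scale a b ≫ prod.snd = b ≫ prod.snd := prod.lift_snd _ _

lemma scale_one {Z X : SchC} (b : Z ⟶ A1 ⨯ X) : scale (constA1 Z 1) b = b := by
  rw [scale, mulA1_one, ← prod.comp_lift, prod.lift_fst_snd, Category.comp_id]

/-- The zero section `X ⟶ 𝔸¹ × X`. -/
def zeroSection (X : SchC) : X ⟶ A1 ⨯ X := prod.lift (constA1 X 0) (𝟙 X)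

lemma zeroSection_snd (X : SchC) : zeroSection X ≫ prod.snd = 𝟙 X := prod.lift_snd _ _

lemma scale_zero {Z X : SchC} (b : Z ⟶ A1 ⨯ X) :
    scale (constA1 Z 0) b = b ≫ prod.snd ≫ zeroSection X := by
  rw [scale, mulA1_zero, zeroSection, prod.comp_lift, prod.comp_lift, comp_constA1, comp_constA1,
    Category.comp_id]

/-- The morphism `(U × 𝔸¹) × (𝔸¹ × X) ⟶ U × (𝔸¹ × X)`, `(u, s, t, x) ↦ (u, s t, x)`. -/
def cylScale (U : VarC) (X : SchC) : (cyl U).obj ⨯ (A1 ⨯ X) ⟶ U.obj ⨯ (A1 ⨯ X) :=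
  prod.lift (prod.fst ≫ (cylProj U).hom) (scale (prod.fst ≫ toA1 (cylFun U)) prod.snd)

lemma cylMap_toA1 {U V : VarC} (h : U ⟶ V) :
    (cylMap h).hom ≫ toA1 (cylFun V) = toA1 (cylFun U) := by
  refine a1_hom_ext ?_
  rw [funOf_comp, funOf_toA1, funOf_toA1]
  exact cylLift_fun _ _

lemma cylSection_toA1 (U : VarC) (c : ℂ) :
    (cylSection U c).hom ≫ toA1 (cylFun U) = constA1 U.obj c := by
  refine a1_hom_ext ?_
  rw [funOf_comp, constA1, funOf_toA1, funOf_toA1]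
  exact cylLift_fun _ _

lemma cylMap_cylScale {U V : VarC} (h : U ⟶ V) (X : SchC) :
    prod.map (cylMap h).hom (𝟙 _) ≫ cylScale V X = cylScale U X ≫ prod.map h.hom (𝟙 _) := by
  have hp : (cylMap h).hom ≫ (cylProj V).hom = (cylProj U).hom ≫ h.hom :=
    congrArg (fun t => t.hom) (cylLift_proj (cylProj U ≫ h) (cylFun U))
  rw [cylScale, cylScale, prod.comp_lift, prod.lift_map, comp_scale, prod.map_fst_assoc,
    prod.map_fst_assoc, cylMap_toA1, hp, prod.map_snd, Category.comp_id, Category.comp_id,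
    Category.assoc]

lemma cylSection_cylScale (U : VarC) (X : SchC) (c : ℂ) :
    prod.map (cylSection U c).hom (𝟙 _) ≫ cylScale U X =
      prod.map (𝟙 _) (scale (constA1 _ c) (𝟙 _)) := by
  have hp : (cylSection U c).hom ≫ (cylProj U).hom = 𝟙 _ :=
    congrArg (fun t => t.hom) (cylLift_proj (𝟙 U) (constFun U.obj c))
  refine prod.hom_ext ?_ ?_
  · rw [cylScale, Category.assoc, prod.lift_fst, prod.map_fst_assoc, hp, prod.map_fst]
  · rw [cylScale, Category.assoc, prod.lift_snd, prod.map_snd, comp_scale, comp_scale,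
      prod.map_fst_assoc, cylSection_toA1, prod.map_snd, comp_constA1, comp_constA1]

lemma cylScale_snd (U : VarC) (X : SchC) :
    cylScale U X ≫ prod.map (𝟙 _) prod.snd =
      prod.map (𝟙 _) prod.snd ≫ prod.map (cylProj U).hom (𝟙 _) := by
  refine prod.hom_ext ?_ ?_
  · rw [cylScale, Category.assoc, prod.map_fst, prod.lift_fst_assoc, Category.comp_id,
      Category.assoc, prod.map_fst, prod.map_fst_assoc, Category.id_comp]
  · rw [cylScale, Category.assoc, prod.map_snd, prod.lift_snd_assoc, scale_snd, Category.assoc,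
      prod.map_snd, Category.comp_id, prod.map_snd]

lemma map_cylScale {M : Type w} [Category.{v} M] (E : SchCᵒᵖ ⥤ M) {U V : VarC} (h : U ⟶ V) (X : SchC) {Z : M}
    (z : E.obj (op ((cyl U).obj ⨯ (A1 ⨯ X))) ⟶ Z) :
    E.map (prod.map h.hom (𝟙 _)).op ≫ E.map (cylScale U X).op ≫ z =
      E.map (cylScale V X).op ≫ E.map (prod.map (cylMap h).hom (𝟙 _)).op ≫ z := by
  rw [← E.map_comp_assoc, ← E.map_comp_assoc, ← op_comp, ← op_comp, cylMap_cylScale]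

variable {M : Type w} [Category.{v} M] [HasColimitsOfSize.{0, 0} M] (E : SchCᵒᵖ ⥤ M)

/-- The action on `E(T × (𝔸¹ × X))` of a continuous function on `T` by scaling. -/
def act {T : TopCat.{0}} (α : C(T, ℂ)) (X : SchC) :
    value E T (A1 ⨯ X) ⟶ value E T (A1 ⨯ X) :=
  colimit.desc (diagram E T (A1 ⨯ X))
    { pt := value E T (A1 ⨯ X)
      ι :=
        { app d := E.map (cylScale d.unop.right X).op ≫ valueι E (A1 ⨯ X) (pairMap d.unop.hom α)
          naturality d d' h := by
            -- A morphism `h` of pairs induces `h × 𝔸¹` between the pairs enlarged by `α`, and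
            -- scaling commutes with it; hence the maps form a cocone.
            have hw : pairMap d'.unop.hom α ≫ an.map (cylMap h.unop.right) =
                pairMap d.unop.hom α :=
              (pairMap_cylMap _ _ _).trans (congrArg (pairMap · α) (StructuredArrow.w h.unop))
            refine Eq.trans ?_ (Category.comp_id _).symm
            rw [← map_valueι E (A1 ⨯ X) _ _ (cylMap h.unop.right) hw]
            exact map_cylScale E h.unop.right X _ } }

lemma ι_act {T : TopCat.{0}} (α : C(T, ℂ)) (X : SchC) {U : VarC} (f : T ⟶ an.obj U) :
    valueι E (A1 ⨯ X) f ≫ act E α X =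
      E.map (cylScale U X).op ≫ valueι E (A1 ⨯ X) (pairMap f α) :=
  colimit.ι_desc _ _

/-- Both sides pull back along the same scaling morphism and index the result by `(f ∘ β, α ∘ β)`.
This gives compatibility of the homotopy with the simplicial operators of `Δⁿ_top`. -/
lemma valueMap_act {T T' : TopCat.{0}} (β : T ⟶ T') (α : C(T', ℂ)) (X : SchC) :
    valueMap E β (𝟙 _) ≫ act E (α.comp β.hom) X = act E α X ≫ valueMap E β (𝟙 _) := by
  refine value_hom_ext E fun U f => ?_
  rw [← Category.assoc, ι_valueMap, Category.assoc, ι_act, ← Category.assoc (valueι _ _ _), ι_act, Category.assoc,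
    ι_valueMap, comp_pairMap]
  simp only [prod.map_id_id, op_id, E.map_id, Category.id_comp]

/-- The map `(f, c)` comes from `f` through the section `U → U × 𝔸¹` at `c`, so the colimit relation
removes the extra factor `𝔸¹` and leaves scaling by the constant `c`. -/
lemma act_const {T : TopCat.{0}} (c : ℂ) (X : SchC) :
    act E (ContinuousMap.const T c) X = valueMap E (𝟙 T) (scale (constA1 _ c) (𝟙 (A1 ⨯ X))) := by
  refine value_hom_ext E fun U f => ?_
  rw [ι_act, ι_valueMap, Category.id_comp,
    ← map_valueι E (A1 ⨯ X) f _ (cylSection U c) (comp_cylSection f c), ← E.map_comp_assoc,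
    ← op_comp, cylSection_cylScale]

lemma act_one (T : TopCat.{0}) (X : SchC) : act E (ContinuousMap.const T 1) X = 𝟙 _ := by
  rw [act_const, scale_one, valueMap_id]

lemma act_zero (T : TopCat.{0}) (X : SchC) :
    act E (ContinuousMap.const T 0) X =
      valueMap E (𝟙 T) (zeroSection X) ≫ valueMap E (𝟙 T) prod.snd := by
  rw [act_const, scale_zero, Category.id_comp, valueMap_comp, Category.id_comp]

/-- Scaling does not move the `X` coordinate, so a class coming from `X` is merely pulled back along
`U × 𝔸¹ → U`. That is a morphism of pairs from `(f, α)` to `f`, hence changes nothing in the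
colimit. -/
lemma valueMap_snd_act {T : TopCat.{0}} (α : C(T, ℂ)) (X : SchC) :
    valueMap E (𝟙 T) (prod.snd : A1 ⨯ X ⟶ X) ≫ act E α X = valueMap E (𝟙 T) prod.snd := by
  refine value_hom_ext E fun U f => ?_
  rw [← Category.assoc, ι_valueMap, Category.assoc, Category.id_comp, ι_act, ← E.map_comp_assoc,
    ← op_comp, cylScale_snd, op_comp, E.map_comp_assoc,
    map_swap, map_valueι E _ _ f (cylProj U) (pairMap_proj f α)]

end Scaling

/-! ### The contracting homotopy on the diagonal -/

section Diagonal

universe v w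

open scoped Simplicial
open MonoidalCategory CartesianMonoidalCategory

lemma map_comp_app_apply {M : Type w} [Category.{v} M] (F : M ⥤ SSet.{u}) {A B C : M} (a : A ⟶ B)
    (b : B ⟶ C) {n : SimplexCategoryᵒᵖ} (x : (F.obj A).obj n) :
    (F.map (a ≫ b)).app n x = (F.map b).app n ((F.map a).app n x) := by
  rw [F.map_comp]
  rfl

variable {M : Type w} [Category.{v} M] [HasColimitsOfSize.{0, 0} M] (E : SchCᵒᵖ ⥤ M)
  (F : M ⥤ SSet.{u})

/-- The diagonal of the bisimplicial set `n ↦ F(E(Δⁿ_top × X))`. -/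
abbrev diagSemi : SchCᵒᵖ ⥤ SSet.{u} :=
  semi E ⋙ (SimplicialObject.whiskering M SSet.{u}).obj F ⋙ bisimplicialDiag (C := Type u)

/-- The coordinate at the vertex `0` of the map `Δⁿ → Δ¹` belonging to an `n`-simplex of
`Δ[1]`. -/
def coordFun {n : SimplexCategoryᵒᵖ} (x : (Δ[1] : SSet.{u}).obj n) :
    C(topSimplex.obj n.unop, ℂ) where
  toFun t := ((stdSimplex.map (SSet.stdSimplex.objEquiv x) t : stdSimplex ℝ (Fin 2)) 0 : ℝ)
  continuous_toFun := by
    refine Complex.continuous_ofReal.comp ?_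
    exact (continuous_apply (0 : Fin 2)).comp (continuous_subtype_val.comp
      (stdSimplex.continuous_map (S := ℝ) (SSet.stdSimplex.objEquiv x)))

lemma coordFun_map {n m : SimplexCategoryᵒᵖ} (θ : n ⟶ m) (x : (Δ[1] : SSet.{u}).obj n) :
    coordFun ((Δ[1] : SSet.{u}).map θ x) = (coordFun x).comp (topSimplex.map θ.unop).hom := by
  refine ContinuousMap.ext fun t => ?_
  refine congrArg (fun z : stdSimplex ℝ (Fin 2) => ((z 0 : ℝ) : ℂ)) ?_
  exact (stdSimplex.map_comp_apply (S := ℝ) θ.unop (SSet.stdSimplex.objEquiv x) t).symm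

/-- Orients the homotopy: vertex `0` of `Δ[1]` scales by `1`, giving the identity, and vertex `1`
scales by `0`, giving the retraction. -/
lemma coordFun_const {n : SimplexCategoryᵒᵖ} (i : Fin 2) :
    coordFun (SSet.stdSimplex.const.{u} 1 i n) =
      ContinuousMap.const _ (if i = 0 then 1 else 0) := by
  refine ContinuousMap.ext fun t => ?_
  refine (congrArg (fun z : stdSimplex ℝ (Fin 2) => ((z 0 : ℝ) : ℂ))
    (stdSimplex_map_const i t)).trans ?_
  fin_cases i <;> simp

/-- The scaling homotopy of the diagonal. -/
def scalingHomotopy (X : SchC) :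
    (diagSemi E F).obj (op (A1 ⨯ X)) ⊗ Δ[1] ⟶ (diagSemi E F).obj (op (A1 ⨯ X)) where
  app n := ↾fun p => (F.map (act E (coordFun p.2) X)).app n p.1
  naturality n m θ := by
    ext ⟨x, y⟩
    change (F.map (act E (coordFun ((Δ[1] : SSet.{u}).map θ y)) X)).app m
      ((F.obj _).map θ ((F.map (valueMap E (topSimplex.map θ.unop) (𝟙 _))).app n x)) =
      (F.obj _).map θ ((F.map (valueMap E (topSimplex.map θ.unop) (𝟙 _))).app n
        ((F.map (act E (coordFun y) X)).app n x))
    -- A structure map of the diagonal combines a change of `Δⁿ_top` with a simplicial operator of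
    -- `F`. The action commutes with the first by `valueMap_act` and with the second because `F.map`
    -- of it is simplicial.
    have h := congrArg (fun t => (F.map t).app n x)
      (valueMap_act E (topSimplex.map θ.unop) (coordFun y) X)
    rw [coordFun_map]
    refine (NatTrans.naturality_apply (F.map (act E _ X)) θ _).trans ?_
    refine congrArg ((F.obj _).map θ) ?_
    exact (map_comp_app_apply F _ _ _).symm.trans (h.trans (map_comp_app_apply F _ _ _))

/-- The action is formed in `M` before `F` is applied, so `F` need not preserve the colimits
defining `E(T × X)`. This freedom covers simplicial sets, pointed simplicial sets and each level of
a spectrum at once. -/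
lemma diagSemi_realizedRetract (X : SchC) :
    RealizedRetract ((diagSemi E F).map (prod.snd : A1 ⨯ X ⟶ X).op)
      ((diagSemi E F).map (zeroSection X).op) := by
  refine ⟨?_, exists_realization_homotopy _ _ (scalingHomotopy E F X) ?_ ?_ ?_⟩
  · rw [← Functor.map_comp, ← op_comp, zeroSection_snd, op_id, CategoryTheory.Functor.map_id]
  · ext n x
    change (F.map (act E (coordFun (SSet.stdSimplex.const.{u} 1 0 n)) X)).app n x = x
    rw [coordFun_const, if_pos rfl, act_one, F.map_id]
    rfl
  · ext n x
    change (F.map (act E (coordFun (SSet.stdSimplex.const.{u} 1 1 n)) X)).app n x =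
      (F.map (valueMap E (𝟙 _) prod.snd)).app n ((F.map (valueMap E (𝟙 _) (zeroSection X))).app n x)
    rw [coordFun_const, if_neg (by decide), act_zero]
    exact map_comp_app_apply F _ _ _
  · ext n ⟨x, y⟩
    change (F.map (act E (coordFun y) X)).app n ((F.map (valueMap E (𝟙 _) prod.snd)).app n x) =
      (F.map (valueMap E (𝟙 _) prod.snd)).app n x
    have h := congrArg (fun t => (F.map t).app n x) (valueMap_snd_act E (coordFun y) X)
    exact (map_comp_app_apply F _ _ _).symm.trans h

end Diagonal



end

end SemiTop

theorem theorem4p4 (X : SemiTop.SchC) :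
    (∀ E : SemiTop.SchCᵒᵖ ⥤ SSet.{u},
      SemiTop.SSetWeq ((SemiTop.sstSSet E).map (prod.snd : SemiTop.A1 ⨯ X ⟶ X).op)) ∧
    (∀ E : SemiTop.SchCᵒᵖ ⥤ SemiTop.PSSet.{u},
      SemiTop.PSSetWeq ((SemiTop.sstPSSet E).map (prod.snd : SemiTop.A1 ⨯ X ⟶ X).op)) ∧
    (∀ E : SemiTop.SchCᵒᵖ ⥤ SemiTop.Spectrum.{u},
      SemiTop.Spectrum.Weq
        ((SemiTop.sstSpectrum E).map (prod.snd : SemiTop.A1 ⨯ X ⟶ X).op)) := by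
  refine ⟨fun E => ?_, fun E => ?_, fun E => ?_⟩
  -- In each case the underlying simplicial set of the semi-topologization is, by definition, the
  -- diagonal for `F` the identity, `forgetP`, or `level n` followed by `forgetP`.
  · exact (SemiTop.diagSemi_realizedRetract E (𝟭 _) X).sSetWeq
  · exact (SemiTop.diagSemi_realizedRetract E SemiTop.forgetP X).sSetWeq
  · exact SemiTop.Spectrum.weq_of_realizedRetract _
      ((SemiTop.sstSpectrum E).map (SemiTop.zeroSection X).op) fun n =>
        SemiTop.diagSemi_realizedRetract E (SemiTop.Spectrum.level n ⋙ SemiTop.forgetP) X
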